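/- Let $\ell$ be an odd prime, let $K$ be a number field, and let $L/K$ be a finite Galois extension whose degree is a power of $\ell$. Assume that $L$ satisfies the Leopoldt conjecture for $\ell$, and that $L$ is linearly disjoint over $K$ from the cyclotomic $\mathbb{Z}_\ell$-extension $K^c$ of $K$. For a number field $F$, write $\mathcal{R}_F=\mathbb{Z}_\ell\otimes_{\mathbb{Z}}F^\times$, let $\mathcal{D}'_F$ be the free $\mathbb{Z}_\ell$-module on the primes of $F$ not dividing $\ell$, and for a place $v$ put $\mathcal{R}_{F_v}=\varprojlim_n F_v^\times/F_v^{\times\ell^n}$. Let $\mathcal{R}^{bp}_F\subset\mathcal{R}_F$ be the submodule of pseudo-infinitesimal elements, i.e. those whose image in $\mathcal{R}_{F_v}$ is (the image of) a root of unity of $F_v$ for every $v\mid\ell$. Let $\mathcal{P}^{bp}_F\subset\mathcal{D}'_F$ be the group of divisors of these elements, and let $\mathcal{C}\ell^{bp}_F=\mathcal{D}'_F/\mathcal{P}^{bp}_F$ (its torsion submodule is the Bertrandias–Payan module of $F$). Let $Cap^{bp}_{L/K}$ be the kernel of the morphism $\mathcal{C}\ell^{bp}_K\to\mathcal{C}\ell^{bp}_L$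 induced by extension of ideals. An extension $M/K$ contained in $L$ is called locally cyclotomic if for every place $v$ of $K$ and every place $w$ of $M$ above $v$ the local extension $M_w/K_v$ is contained in the cyclotomic $\mathbb{Z}_\ell$-extension $K_v^c$ of $K_v$, where $K_v^c=K_v\mathbb{Q}^c$ and $\mathbb{Q}^c$ is the cyclotomic $\mathbb{Z}_\ell$-extension of $\mathbb{Q}$. Let $L'$ be the compositum of all locally cyclotomic subextensions of $L/K$. Let $\mu_K$ be the group of roots of unity of $\ell$-power order in $K$. Then $L'/K$ is the largest locally cyclotomic subextension of $L/K$, it is Galois, and with $G'=\mathrm{Gal}(L'/K)$ there is an isomorphism of groups $$Cap^{bp}_{L/K}\simeq \mathrm{Hom}(G',\mu_K).$$ -/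

import Mathlib

open NumberField IsDedekindDomain
open scoped TensorProduct

noncomputable section

namespace BertrandiasPayan

section ProL

variable (ℓ : ℕ) [Fact ℓ.Prime]

/-- The canonical map `ℤ_ℓ → lim ℤ/ℓⁿ`. -/
def padicIntToAdic : ℤ_[ℓ] →+* AdicCompletion (Ideal.span {(ℓ : ℤ)}) ℤ :=
  AdicCompletion.liftRingHom (Ideal.span {(ℓ : ℤ)})
    (fun n => ((Ideal.quotEquivOfEq (by
        rw [Ideal.span_singleton_pow, Nat.cast_pow] :
          Ideal.span {((ℓ ^ n : ℕ) : ℤ)} = Ideal.span {(ℓ : ℤ)} ^ n)).toRingHom.comp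
      (Int.quotientSpanNatEquivZMod (ℓ ^ n)).symm.toRingHom).comp (PadicInt.toZModPow n))
    (by
      intro m n hle
      ext x
      have h := PadicInt.cast_toZModPow m n hle x
      obtain ⟨k, hk⟩ := ZMod.intCast_surjective (PadicInt.toZModPow n x)
      have hk' : PadicInt.toZModPow m x = (k : ZMod (ℓ ^ m)) := by
        rw [← h, ← hk, ZMod.cast_intCast (pow_dvd_pow ℓ hle)]
      simp only [RingHom.comp_apply, hk', ← hk, map_intCast])

variable (F : Type*) [Field F]

/-- The `ℓ`-adic compactification `lim F^×/F^{×ℓⁿ}` of the multiplicative group of `F`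
(written additively). -/
def ProL : Type _ := AdicCompletion (Ideal.span {(ℓ : ℤ)}) (Additive Fˣ)

instance : AddCommGroup (ProL ℓ F) :=
  inferInstanceAs (AddCommGroup (AdicCompletion (Ideal.span {(ℓ : ℤ)}) (Additive Fˣ)))

/-- The structure of module over `lim ℤ/ℓⁿ`, used only to define the `ℤ_ℓ`-structure below. -/
instance : Module (AdicCompletion (Ideal.span {(ℓ : ℤ)}) ℤ) (ProL ℓ F) :=
  inferInstanceAs (Module (AdicCompletion (Ideal.span {(ℓ : ℤ)}) ℤ)
    (AdicCompletion (Ideal.span {(ℓ : ℤ)}) (Additive Fˣ)))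

instance : Module ℤ_[ℓ] (ProL ℓ F) := Module.compHom (ProL ℓ F) (padicIntToAdic ℓ)

/-- The canonical map `F^× → lim F^×/F^{×ℓⁿ}`. -/
def toProL : Additive Fˣ →+ ProL ℓ F :=
  (AdicCompletion.of (Ideal.span {(ℓ : ℤ)}) (Additive Fˣ)).toAddMonoidHom

/-- The `ℓ`-group of roots of unity of `F`: the elements of `ℓ`-power order of `F^×`. -/
abbrev mu : Subgroup Fˣ := CommGroup.primaryComponent Fˣ ℓ

/-- The image of the `ℓ`-group of roots of unity of `F` in `lim F^×/F^{×ℓⁿ}`. -/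
def muProL : Submodule ℤ_[ℓ] (ProL ℓ F) where
  carrier := {x | ∃ ζ ∈ mu ℓ F, x = toProL ℓ F (Additive.ofMul ζ)}
  zero_mem' := ⟨1, one_mem _, by simp⟩
  add_mem' := by
    rintro _ _ ⟨ζ, hζ, rfl⟩ ⟨ξ, hξ, rfl⟩
    exact ⟨ζ * ξ, mul_mem hζ hξ, by rw [ofMul_mul, map_add]⟩
  smul_mem' := by
    rintro a _ ⟨ζ, ⟨n, hn⟩, rfl⟩
    refine ⟨ζ ^ (a.appr n), pow_mem (show ζ ∈ mu ℓ F from ⟨n, hn⟩) _, ?_⟩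
    obtain ⟨b, hb⟩ := Ideal.mem_span_singleton'.1 (PadicInt.appr_spec n a)
    have ha : a = b * (ℓ : ℤ_[ℓ]) ^ n + (a.appr n : ℤ_[ℓ]) := by rw [hb]; ring
    have h0 : ((ℓ : ℤ_[ℓ]) ^ n) • toProL ℓ F (Additive.ofMul ζ) = 0 := by
      rw [← Nat.cast_pow, Nat.cast_smul_eq_nsmul, ← map_nsmul, ← ofMul_pow, hn, ofMul_one, map_zero]
    conv_lhs => rw [ha, add_smul, mul_smul, h0, smul_zero, zero_add, Nat.cast_smul_eq_nsmul,
      ← map_nsmul, ← ofMul_pow]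

variable {F} {E : Type*} [Field E]

/-- Functoriality of `ProL` for field embeddings. -/
def ProL.map (f : F →+* E) : ProL ℓ F →ₗ[ℤ_[ℓ]] ProL ℓ E where
  toFun := AdicCompletion.map (Ideal.span {(ℓ : ℤ)})
    (Units.map (f : F →* E)).toAdditive.toIntLinearMap
  map_add' := map_add _
  map_smul' a x := map_smul (AdicCompletion.map (Ideal.span {(ℓ : ℤ)})
    (Units.map (f : F →* E)).toAdditive.toIntLinearMap) (padicIntToAdic ℓ a) x

lemma ProL.map_toProL (f : F →+* E) (x : Additive Fˣ) :
    ProL.map ℓ f (toProL ℓ F x) =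
      toProL ℓ E ((Units.map (f : F →* E)).toAdditive x) :=
  AdicCompletion.map_of _ _ _

end ProL

section Adified

variable (ℓ : ℕ) [Fact ℓ.Prime]

/-- The `ℓ`-adification `ℤ_ℓ ⊗_ℤ K^×` of the multiplicative group of `K`. -/
abbrev Adified (K : Type*) [Field K] : Type _ := ℤ_[ℓ] ⊗[ℤ] Additive Kˣ

/-- The canonical map `ℤ_ℓ ⊗_ℤ K^× → lim F^×/F^{×ℓⁿ}` attached to a field embedding `K → F`. -/
def toLocal {K F : Type*} [Field K] [Field F] (f : K →+* F) : Adified ℓ K →ₗ[ℤ_[ℓ]] ProL ℓ F :=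
  LinearMap.liftBaseChange ℤ_[ℓ]
    ((toProL ℓ F).comp (Units.map (f : K →* F)).toAdditive).toIntLinearMap

/-- The map `ℤ_ℓ ⊗_ℤ K^× → ℤ_ℓ ⊗_ℤ L^×` attached to a field extension `L/K`. -/
def Adified.map (K L : Type*) [Field K] [Field L] [Algebra K L] :
    Adified ℓ K →ₗ[ℤ_[ℓ]] Adified ℓ L :=
  LinearMap.baseChange ℤ_[ℓ]
    (Units.map (algebraMap K L : K →* L)).toAdditive.toIntLinearMap

end Adified

section Completions

variable (K : Type*) {L : Type*} [Field K] [NumberField K] [Field L] [NumberField L] [Algebra K L]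

/-- The embedding of local fields `K_v → L_w`, for a finite place `w` of `L` and `v` the place of
`K` below `w`; it is the continuous extension of `K → L`. -/
def localMap (w : HeightOneSpectrum (𝓞 L)) :
    (w.under (𝓞 K)).adicCompletion K →+* w.adicCompletion L :=
  haveI : w.asIdeal.LiesOver (w.under (𝓞 K)).asIdeal := ⟨rfl⟩
  ((HeightOneSpectrum.adicCompletion.equiv L w).symm.toRingHom.comp
    (UniformSpace.Completion.mapRingHom _
      (HeightOneSpectrum.uniformContinuous_algebraMap_liesOver K L
        (w.under (𝓞 K)) w).continuous)).comp
    (HeightOneSpectrum.adicCompletion.equiv K (w.under (𝓞 K))).toRingHom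

lemma localMap_algebraMap (w : HeightOneSpectrum (𝓞 L)) (x : K) :
    localMap K w (algebraMap K ((w.under (𝓞 K)).adicCompletion K) x) =
      algebraMap L (w.adicCompletion L) (algebraMap K L x) := by
  have : w.asIdeal.LiesOver (w.under (𝓞 K)).asIdeal := ⟨rfl⟩
  exact congrArg (HeightOneSpectrum.adicCompletion.equiv L w).symm
    (UniformSpace.Completion.mapRingHom_coe
      (HeightOneSpectrum.uniformContinuous_algebraMap_liesOver K L
        (w.under (𝓞 K)) w).continuous (WithVal.toVal _ x))

end Completions

section Places

/-- The finite places of `K` not dividing `ℓ`. -/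
abbrev TamePlace (ℓ : ℕ) (K : Type*) [Field K] : Type _ :=
  {v : HeightOneSpectrum (𝓞 K) // (ℓ : 𝓞 K) ∉ v.asIdeal}

/-- The normalized valuation `ord_v : K^× → ℤ`. -/
def ord {K : Type*} [Field K] [NumberField K] (v : HeightOneSpectrum (𝓞 K)) (x : Kˣ) : ℤ :=
  -(v.valuationOfNeZero x).toAdd

lemma ord_mul {K : Type*} [Field K] [NumberField K] (v : HeightOneSpectrum (𝓞 K)) (x y : Kˣ) :
    ord v (x * y) = ord v x + ord v y := by
  rw [ord, map_mul, toAdd_mul, neg_add, ord, ord]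

lemma ord_one {K : Type*} [Field K] [NumberField K] (v : HeightOneSpectrum (𝓞 K)) :
    ord v (1 : Kˣ) = 0 := by
  rw [ord, map_one, toAdd_one, neg_zero]

lemma exp_neg_ord {K : Type*} [Field K] [NumberField K] (v : HeightOneSpectrum (𝓞 K)) (x : Kˣ) :
    WithZero.exp (-ord v x) = v.valuation K (x : K) := by
  rw [← HeightOneSpectrum.valuationOfNeZero_eq, ord, neg_neg]
  rfl

lemma ord_finite {K : Type*} [Field K] [NumberField K] (x : Kˣ) :
    {v : HeightOneSpectrum (𝓞 K) | ord v x ≠ 0}.Finite := by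
  refine ((HeightOneSpectrum.Support.finite (𝓞 K) (x : K)).union
    (HeightOneSpectrum.Support.finite (𝓞 K) ((x⁻¹ : Kˣ) : K))).subset fun v hv => ?_
  have h : ord v x⁻¹ = -ord v x := by
    have := ord_mul v x x⁻¹
    rw [mul_inv_cancel, ord_one] at this
    omega
  rcases lt_or_gt_of_ne (show ord v x ≠ 0 from hv) with h0 | h0
  · left
    change 1 < v.valuation K (x : K)
    rw [← exp_neg_ord, ← WithZero.exp_zero, WithZero.exp_lt_exp]
    omega
  · right
    change 1 < v.valuation K ((x⁻¹ : Kˣ) : K)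
    rw [← exp_neg_ord, ← WithZero.exp_zero, WithZero.exp_lt_exp]
    omega

lemma ord_map {K L : Type*} [Field K] [NumberField K] [Field L] [NumberField L] [Algebra K L]
    (w : HeightOneSpectrum (𝓞 L)) (x : Kˣ) :
    ord w (Units.map (algebraMap K L : K →* L) x) =
      (w.under (𝓞 K)).asIdeal.ramificationIdx' w.asIdeal * ord (w.under (𝓞 K)) x := by
  have : w.asIdeal.LiesOver (w.under (𝓞 K)).asIdeal := ⟨rfl⟩
  have h := HeightOneSpectrum.valuation_liesOver L (w.under (𝓞 K)) w (x : K)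
  rw [← exp_neg_ord, ← WithZero.exp_nsmul,
    show algebraMap K L (x : K) = ((Units.map (algebraMap K L : K →* L) x : Lˣ) : L) from rfl,
    ← exp_neg_ord, WithZero.exp_inj, nsmul_eq_mul] at h
  linarith

lemma under_tame {ℓ : ℕ} (K : Type*) {L : Type*} [Field K] [NumberField K] [Field L]
    [NumberField L] [Algebra K L] (w : TamePlace ℓ L) :
    (ℓ : 𝓞 K) ∉ (w.1.under (𝓞 K)).asIdeal := fun h =>
  w.2 (by simpa using (Ideal.mem_comap.1 h))

lemma under_finite {K : Type*} (L : Type*) [Field K] [NumberField K] [Field L]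
    [NumberField L] [Algebra K L] (v : HeightOneSpectrum (𝓞 K)) :
    {w : HeightOneSpectrum (𝓞 L) | w.under (𝓞 K) = v}.Finite := by
  have := v.isPrime
  have := v.isMaximal
  refine Set.Finite.of_finite_image (f := HeightOneSpectrum.asIdeal)
    ((IsDedekindDomain.primesOver_finite (B := 𝓞 L) v.asIdeal).subset ?_)
    (fun _ _ _ _ h => HeightOneSpectrum.ext h)
  rintro _ ⟨w, rfl, rfl⟩
  exact ⟨w.isPrime, ⟨rfl⟩⟩

end Places

section Divisors

variable (ℓ : ℕ) [Fact ℓ.Prime]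

/-- The group of divisors `D'_K`: the free `ℤ_ℓ`-module on the primes of `K` not dividing `ℓ`. -/
abbrev Divisors (K : Type*) [Field K] : Type _ := TamePlace ℓ K →₀ ℤ_[ℓ]

/-- The divisor (away from `ℓ`) of an element of `K^×`. -/
def divUnits (K : Type*) [Field K] [NumberField K] : Additive Kˣ →+ Divisors ℓ K where
  toFun x := Finsupp.ofSupportFinite (fun v => (ord v.1 x.toMul : ℤ_[ℓ])) (by
    refine ((ord_finite x.toMul).preimage Subtype.val_injective.injOn).subset fun v hv h => hv ?_
    change ((ord v.1 x.toMul : ℤ) : ℤ_[ℓ]) = 0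
    rw [h, Int.cast_zero])
  map_zero' := by
    ext v
    change ((ord v.1 (1 : Kˣ) : ℤ) : ℤ_[ℓ]) = 0
    rw [ord_one, Int.cast_zero]
  map_add' x y := by
    ext v
    change ((ord v.1 (x.toMul * y.toMul) : ℤ) : ℤ_[ℓ]) = (ord v.1 x.toMul : ℤ_[ℓ]) + ord v.1 y.toMul
    rw [ord_mul, Int.cast_add]

/-- The divisor map `ℤ_ℓ ⊗_ℤ K^× → D'_K`. -/
def divisor (K : Type*) [Field K] [NumberField K] : Adified ℓ K →ₗ[ℤ_[ℓ]] Divisors ℓ K :=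
  LinearMap.liftBaseChange ℤ_[ℓ] (divUnits ℓ K).toIntLinearMap

/-- The pseudo-infinitesimal elements of `ℤ_ℓ ⊗_ℤ K^×`: those whose image in
`lim K_v^×/K_v^{×ℓⁿ}` is a root of unity of `K_v`, for all places `v` dividing `ℓ`. -/
def pseudoInfinitesimal (K : Type*) [Field K] [NumberField K] : Submodule ℤ_[ℓ] (Adified ℓ K) :=
  ⨅ (v : HeightOneSpectrum (𝓞 K)) (_ : (ℓ : 𝓞 K) ∈ v.asIdeal),
    (muProL ℓ (v.adicCompletion K)).comap (toLocal ℓ (algebraMap K (v.adicCompletion K)))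

/-- The group of divisors of the pseudo-infinitesimal elements. -/
def principalBP (K : Type*) [Field K] [NumberField K] : Submodule ℤ_[ℓ] (Divisors ℓ K) :=
  (pseudoInfinitesimal ℓ K).map (divisor ℓ K)

/-- The group of pseudo-infinitesimal classes, whose torsion submodule is the
Bertrandias-Payan module. -/
abbrev ClBP (K : Type*) [Field K] [NumberField K] : Type _ := Divisors ℓ K ⧸ principalBP ℓ K

variable (K L : Type*) [Field K] [NumberField K] [Field L] [NumberField L] [Algebra K L]

/-- The extension of divisors `D'_K → D'_L`: it maps a prime `𝔭` of `K` to the product of the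
`𝔓 ^ e(𝔓|𝔭)` for `𝔓` above `𝔭`, so that the coefficient at `𝔓` of the extension of `𝔞` is
`e(𝔓|𝔭)` times the coefficient at `𝔭` of `𝔞`. -/
def extDivisor : Divisors ℓ K →ₗ[ℤ_[ℓ]] Divisors ℓ L where
  toFun a := Finsupp.ofSupportFinite
    (fun w => ((w.1.under (𝓞 K)).asIdeal.ramificationIdx' w.1.asIdeal : ℤ_[ℓ]) *
      a ⟨w.1.under (𝓞 K), under_tame K w⟩) (by
    refine (((a.support.finite_toSet.image Subtype.val).biUnion
      fun v _ => under_finite L v).preimage Subtype.val_injective.injOn).subset fun w hw => ?_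
    simp only [Set.mem_preimage, Set.mem_iUnion]
    refine ⟨w.1.under (𝓞 K), ⟨⟨w.1.under (𝓞 K), under_tame K w⟩, ?_, rfl⟩, rfl⟩
    simp only [Finset.mem_coe, Finsupp.mem_support_iff]
    exact fun h => hw ((congrArg _ h).trans (mul_zero _)))
  map_add' a b := by ext w; exact mul_add _ _ _
  map_smul' c a := by ext w; exact mul_left_comm _ _ _

lemma divisor_map (x : Adified ℓ K) :
    divisor ℓ L (Adified.map ℓ K L x) = extDivisor ℓ K L (divisor ℓ K x) := by
  induction x using TensorProduct.induction_on with
  | zero => simp only [map_zero]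
  | add x y hx hy => simp only [map_add, hx, hy]
  | tmul a x =>
    rw [divisor, divisor, Adified.map, LinearMap.baseChange_tmul, LinearMap.liftBaseChange_tmul,
      LinearMap.liftBaseChange_tmul, map_smul]
    congr 1
    ext w
    change ((ord w.1 (Units.map (algebraMap K L : K →* L) x.toMul) : ℤ) : ℤ_[ℓ]) =
      ((w.1.under (𝓞 K)).asIdeal.ramificationIdx' w.1.asIdeal : ℤ_[ℓ]) *
        ((ord (w.1.under (𝓞 K)) x.toMul : ℤ) : ℤ_[ℓ])
    rw [ord_map, Int.cast_mul, Int.cast_natCast]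

lemma toLocal_map (w : HeightOneSpectrum (𝓞 L)) (x : Adified ℓ K) :
    toLocal ℓ (algebraMap L (w.adicCompletion L)) (Adified.map ℓ K L x) =
      ProL.map ℓ (localMap K w) (toLocal ℓ (algebraMap K ((w.under (𝓞 K)).adicCompletion K)) x) := by
  induction x using TensorProduct.induction_on with
  | zero => simp only [map_zero]
  | add x y hx hy => simp only [map_add, hx, hy]
  | tmul a x =>
    rw [toLocal, toLocal, Adified.map, LinearMap.baseChange_tmul, LinearMap.liftBaseChange_tmul,
      LinearMap.liftBaseChange_tmul, map_smul]
    congr 1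
    refine Eq.trans ?_ (ProL.map_toProL ℓ (localMap K w) _).symm
    refine congrArg (toProL ℓ (w.adicCompletion L)) ?_
    refine congrArg Additive.ofMul (Units.ext ?_)
    exact (localMap_algebraMap K w _).symm

lemma principalBP_le : principalBP ℓ K ≤ (principalBP ℓ L).comap (extDivisor ℓ K L) := by
  rintro _ ⟨x, hx, rfl⟩
  refine ⟨Adified.map ℓ K L x, ?_, divisor_map ℓ K L x⟩
  simp only [pseudoInfinitesimal, SetLike.mem_coe, Submodule.mem_iInf,
    Submodule.mem_comap] at hx ⊢
  intro w hw
  obtain ⟨ζ, ⟨n, hn⟩, h⟩ := hx (w.under (𝓞 K)) (by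
    change algebraMap (𝓞 K) (𝓞 L) ℓ ∈ w.asIdeal
    simpa using hw)
  refine ⟨Units.map (localMap K w : _ →* _) ζ, ⟨n, by rw [← map_pow, hn, map_one]⟩, ?_⟩
  rw [toLocal_map, h, ProL.map_toProL]
  rfl

/-- The extension morphism between the groups of pseudo-infinitesimal classes of `K` and `L`. -/
def extClBP : ClBP ℓ K →ₗ[ℤ_[ℓ]] ClBP ℓ L :=
  Submodule.mapQ _ _ (extDivisor ℓ K L) (principalBP_le ℓ K L)

/-- The capitulation kernel: the classes of `K` which become trivial in `L`. -/
abbrev CapBP : Submodule ℤ_[ℓ] (ClBP ℓ K) := LinearMap.ker (extClBP ℓ K L)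

end Divisors

section Leopoldt

/-- The Leopoldt conjecture for the prime `ℓ` and the number field `K`: the canonical map from
`ℤ_ℓ ⊗_ℤ O_K^×` to the product of the `lim K_v^×/K_v^{×ℓⁿ}`, for `v` dividing `ℓ`, is injective. -/
def LeopoldtConjecture (ℓ : ℕ) [Fact ℓ.Prime] (K : Type*) [Field K] [NumberField K] : Prop :=
  ∀ x : ℤ_[ℓ] ⊗[ℤ] Additive (𝓞 K)ˣ,
    (∀ v : HeightOneSpectrum (𝓞 K), (ℓ : 𝓞 K) ∈ v.asIdeal →
      toLocal ℓ (algebraMap K (v.adicCompletion K))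
        (LinearMap.baseChange ℤ_[ℓ]
          (Units.map (algebraMap (𝓞 K) K : 𝓞 K →* K)).toAdditive.toIntLinearMap x) = 0) →
    x = 0

end Leopoldt

section Cyclotomic

/-- The cyclotomic `ℤ_ℓ`-extension `ℚ^c` of `ℚ`, for `ℓ` odd: the compositum of the subfields of
`ℚ(μ_{ℓ^∞})` whose degree over `ℚ` is a power of `ℓ`. (The Galois group of `ℚ(μ_{ℓ^∞})/ℚ` is
`ℤ_ℓ^× ≃ ℤ/(ℓ-1) × ℤ_ℓ`.) -/
def ratCyclotomic (ℓ : ℕ) : IntermediateField ℚ (AlgebraicClosure ℚ) :=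
  ⨆ E ∈ {E : IntermediateField ℚ (AlgebraicClosure ℚ) |
    E ≤ IntermediateField.adjoin ℚ {ζ | ∃ n : ℕ, ζ ^ ℓ ^ n = 1} ∧
      ∃ n : ℕ, Module.finrank ℚ E = ℓ ^ n}, E

/-- The cyclotomic `ℤ_ℓ`-extension `F^c = F ℚ^c` of a field `F` of characteristic zero, inside an
algebraically closed extension `Ω` of `F`. -/
def cyclotomic (ℓ : ℕ) (F Ω : Type*) [Field F] [Field Ω] [Algebra F Ω] : IntermediateField F Ω :=
  IntermediateField.adjoin F {x | ∃ φ : ratCyclotomic ℓ →+* Ω, x ∈ φ.range}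

/-- An extension `L/K` of number fields is locally cyclotomic (logarithmically unramified) at `ℓ`
if for all finite places `w` of `L`, above a place `v` of `K`, the local extension `L_w/K_v` is
contained in the cyclotomic `ℤ_ℓ`-extension of `K_v`. (For `ℓ` odd and `L` inside an `ℓ`-extension of
`K`, the infinite places split completely and impose no condition.) -/
def IsLocallyCyclotomic (ℓ : ℕ) (K L : Type*) [Field K] [NumberField K] [Field L] [NumberField L]
    [Algebra K L] : Prop :=
  ∀ w : HeightOneSpectrum (𝓞 L),
    ∃ φ : w.adicCompletion L →+* AlgebraicClosure ((w.under (𝓞 K)).adicCompletion K),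
      φ.comp (localMap K w) = algebraMap _ _ ∧
      ∀ x, φ x ∈ cyclotomic ℓ ((w.under (𝓞 K)).adicCompletion K)
        (AlgebraicClosure ((w.under (𝓞 K)).adicCompletion K))

/-- The compositum of the locally cyclotomic subextensions of `L/K`. -/
def maxLocallyCyclotomic (ℓ : ℕ) (K L : Type*) [Field K] [NumberField K] [Field L] [NumberField L]
    [Algebra K L] : IntermediateField K L :=
  ⨆ M ∈ {M : IntermediateField K L | IsLocallyCyclotomic ℓ K M}, M

end Cyclotomic

end BertrandiasPayan

end

/-!
The proof compares the capitulation kernel with a group of Kummer characters.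

Call *trivialization* a pair `(𝔞, x)` of a divisor `𝔞` of `K` and a pseudo-infinitesimal element `x`
of `ℤ_ℓ ⊗ L^×` whose divisor is the extension of `𝔞` to `L`. The class of `𝔞` lies in the
capitulation kernel and every class of the kernel arises in this way. For `σ` in `G = Gal(L/K)` the
difference `σ(x) - x` is pseudo-infinitesimal with trivial divisor. Leopoldt's conjecture for `L`
forces such an element to be a root of unity (`exists_eq_one_tmul_of_divisor_eq_zero`): a multiple of
it by a power of `ℓ` is a unit with trivial images at the places above `ℓ`. As `L/K` is an
`ℓ`-extension linearly disjoint from the cyclotomic `ℤ_ℓ`-extension, the roots of unity of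
`ℓ`-power order of `L` lie in `K` (`exists_algebraMap_eq_of_pow_eq_one`). Hence `σ ↦ σ(x) - x` is a
homomorphism `G → μ_K`. It is trivial if and only if `x` comes from `ℤ_ℓ ⊗ K^×`, by flatness of
`ℤ_ℓ` over `ℤ`, and this happens if and only if the class of `𝔞` is trivial
(`ker_trivializationsToCap`). So the capitulation kernel is isomorphic to the group of those
characters `χ : G → μ_K` which are coboundaries of trivializations.

By Hilbert's theorem 90, every `χ` is of the form `σ ↦ σ(x₀)/x₀`, with `a = x₀ ^ ℓⁿ` in `K^×` for some
`n` such that `K` contains a primitive `ℓⁿ`-th root of unity. A trivialization with coboundary `χ`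
is the product of `x₀` by an element of `ℤ_ℓ ⊗ K^×`. The map from `ℤ_ℓ ⊗ K^×` to the product of
the groups `lim K_v^×/K_v^{×ℓⁿ}` for `v ∣ ℓ` is surjective, by weak approximation and compactness
(`exists_forall_toLocal_eq`), so the existence of such a trivialization is a local condition: `a`
belongs to `μ_{K_v} K_v^{×ℓⁿ}` for every finite place `v` of `K`
(`exists_mem_pseudoInfinitesimal_iff`). For `v ∤ ℓ` this condition says that `ℓⁿ` divides the
valuation of `a` (`pow_dvd_ord_iff`), that is, that the divisor of `x₀` comes from `K`. By local
Kummer theory (`mem_cyclotomic_iff`) the condition at `v` means exactly that `K_v(a ^ (1/ℓⁿ))` is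
contained in the cyclotomic `ℤ_ℓ`-extension of `K_v`. So the characters obtained are those whose
radical `x₀` lies in the field of all elements of `L` whose local conjugates are in the cyclotomic
`ℤ_ℓ`-extensions. That field is the largest locally cyclotomic subextension `L'`
(`maxLocallyCyclotomic_eq`), and the characters are those which factor through `Gal(L'/K)`.
-/

open NumberField IsDedekindDomain
open scoped TensorProduct

noncomputable section

namespace BertrandiasPayan

/-! ### The `ℓ`-adic compactification of the multiplicative group of a field -/

section ProL

variable (ℓ : ℕ) {F : Type*} [Field F]

/-- The `n`-th component `lim F^×/F^{×ℓᵏ} → F^×/F^{×ℓⁿ}`. -/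
def ProL.red (n : ℕ) : ProL ℓ F →+
    Additive Fˣ ⧸ (Ideal.span {(ℓ : ℤ)} ^ n • ⊤ : Submodule ℤ (Additive Fˣ)) :=
  (AdicCompletion.eval (Ideal.span {(ℓ : ℤ)}) (Additive Fˣ) n).toAddMonoidHom

variable {ℓ}

lemma ProL.ext {x y : ProL ℓ F} (h : ∀ n, ProL.red ℓ n x = ProL.red ℓ n y) : x = y :=
  AdicCompletion.ext h

lemma ProL.red_toProL (n : ℕ) (a : Additive Fˣ) :
    ProL.red ℓ n (toProL ℓ F a) = Submodule.Quotient.mk a := rfl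

lemma ProL.exists_red_eq (n : ℕ) (x : ProL ℓ F) :
    ∃ a : Additive Fˣ, ProL.red ℓ n x = ProL.red ℓ n (toProL ℓ F a) := by
  obtain ⟨a, ha⟩ := Submodule.Quotient.mk_surjective _ (ProL.red ℓ n x)
  exact ⟨a, ha.symm⟩

lemma mem_span_pow_smul_top {A : Type*} [AddCommGroup A] (n : ℕ) (a : A) :
    a ∈ (Ideal.span {(ℓ : ℤ)} ^ n • ⊤ : Submodule ℤ A) ↔ ∃ b : A, a = ℓ ^ n • b := by
  rw [Ideal.span_singleton_pow, Submodule.ideal_span_singleton_smul,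
    Submodule.mem_smul_pointwise_iff_exists]
  constructor
  · rintro ⟨b, -, rfl⟩
    exact ⟨b, by rw [← natCast_zsmul]; push_cast; rfl⟩
  · rintro ⟨b, rfl⟩
    exact ⟨b, trivial, by rw [← natCast_zsmul]; push_cast; rfl⟩

lemma ProL.red_toProL_eq_iff (n : ℕ) (a b : Additive Fˣ) :
    ProL.red ℓ n (toProL ℓ F a) = ProL.red ℓ n (toProL ℓ F b) ↔
      ∃ z : Fˣ, a.toMul = b.toMul * z ^ ℓ ^ n := by
  rw [ProL.red_toProL, ProL.red_toProL, Submodule.Quotient.eq, mem_span_pow_smul_top]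
  refine ⟨fun ⟨c, hc⟩ => ⟨c.toMul, ?_⟩, fun ⟨c, hc⟩ => ⟨Additive.ofMul c, ?_⟩⟩
  · rw [← toMul_nsmul, ← hc, ← toMul_add, add_sub_cancel]
  · apply Additive.toMul.injective
    rw [toMul_sub, hc, mul_div_cancel_left]
    rfl

lemma ProL.red_toProL_eq_zero_iff (n : ℕ) (a : Additive Fˣ) :
    ProL.red ℓ n (toProL ℓ F a) = 0 ↔ ∃ z : Fˣ, a.toMul = z ^ ℓ ^ n := by
  have := ProL.red_toProL_eq_iff (ℓ := ℓ) n a 0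
  rw [map_zero, map_zero] at this
  simpa using this

lemma ProL.red_eq_of_le {m n : ℕ} (hmn : m ≤ n) {x y : ProL ℓ F}
    (h : ProL.red ℓ n x = ProL.red ℓ n y) : ProL.red ℓ m x = ProL.red ℓ m y := by
  have key : ∀ z : ProL ℓ F, ProL.red ℓ m z =
      AdicCompletion.transitionMap (Ideal.span {(ℓ : ℤ)}) (Additive Fˣ) hmn (ProL.red ℓ n z) :=
    fun z => (AdicCompletion.transitionMap_comp_eval_apply _ _ hmn z).symm
  rw [key, key, h]

variable [Fact ℓ.Prime]

lemma ProL.red_pow_smul (n : ℕ) (x : ProL ℓ F) : ProL.red ℓ n ((ℓ : ℤ_[ℓ]) ^ n • x) = 0 := by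
  obtain ⟨a, ha⟩ := ProL.exists_red_eq n x
  rw [← Nat.cast_pow, Nat.cast_smul_eq_nsmul, map_nsmul, ha, ← map_nsmul, ← map_nsmul,
    ProL.red_toProL_eq_zero_iff]
  exact ⟨a.toMul, by rw [toMul_nsmul]⟩

lemma exists_eq_appr_add (n : ℕ) (c : ℤ_[ℓ]) :
    ∃ b : ℤ_[ℓ], c = (c.appr n : ℤ_[ℓ]) + (ℓ : ℤ_[ℓ]) ^ n * b := by
  obtain ⟨b, hb⟩ := Ideal.mem_span_singleton'.1 (PadicInt.appr_spec n c)
  exact ⟨b, by linear_combination -hb⟩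

/-- The reduction of `c • x` depends only on the residue class of `c`. -/
lemma ProL.red_smul_congr (n : ℕ) {c d : ℤ_[ℓ]}
    (h : PadicInt.toZModPow n c = PadicInt.toZModPow n d) (x : ProL ℓ F) :
    ProL.red ℓ n (c • x) = ProL.red ℓ n (d • x) := by
  rw [← sub_eq_zero, ← map_sub, ← RingHom.mem_ker, PadicInt.ker_toZModPow,
    Ideal.mem_span_singleton] at h
  obtain ⟨b, hb⟩ := h
  rw [sub_eq_iff_eq_add.1 hb, add_smul, mul_smul, map_add, ProL.red_pow_smul, zero_add]

lemma ProL.red_map (n : ℕ) {E : Type*} [Field E] (f : F →+* E) {x : ProL ℓ F} {a : Additive Fˣ}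
    (h : ProL.red ℓ n x = ProL.red ℓ n (toProL ℓ F a)) :
    ProL.red ℓ n (ProL.map ℓ f x) =
      ProL.red ℓ n (toProL ℓ E ((Units.map (f : F →* E)).toAdditive a)) := by
  have key : ∀ z : ProL ℓ F, ProL.red ℓ n (ProL.map ℓ f z) =
      LinearMap.reduceModIdeal (Ideal.span {(ℓ : ℤ)} ^ n)
        (Units.map (f : F →* E)).toAdditive.toIntLinearMap (ProL.red ℓ n z) :=
    fun z => AdicCompletion.map_val_apply _ _ _
  rw [key, h, ← key, ProL.map_toProL]

/-- A nonzero `ℓ`-adic integer is a power of `ℓ` times a unit, so that the elements which it kills are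
killed by a power of `ℓ`. -/
lemma exists_pow_smul_eq_zero {M : Type*} [AddCommGroup M] [Module ℤ_[ℓ] M] {c : ℤ_[ℓ]}
    (hc : c ≠ 0) {x : M} (h : c • x = 0) : ∃ k : ℕ, (ℓ : ℤ_[ℓ]) ^ k • x = 0 := by
  refine ⟨c.valuation, ?_⟩
  rw [PadicInt.unitCoeff_spec hc, mul_smul] at h
  rwa [← Units.smul_def, smul_eq_zero_iff_eq] at h

/-- A torsion element of `lim F^×/F^{×ℓⁿ}` comes from a root of unity: an `ℓᵏ`-torsion element is
at each level represented by one of the finitely many roots of unity of order dividing `ℓᵏ`. -/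
theorem mem_muProL_iff {x : ProL ℓ F} :
    x ∈ muProL ℓ F ↔ ∃ k : ℕ, (ℓ : ℤ_[ℓ]) ^ k • x = 0 := by
  constructor
  · rintro ⟨ζ, ⟨k, hk⟩, rfl⟩
    refine ⟨k, ?_⟩
    rw [← Nat.cast_pow, Nat.cast_smul_eq_nsmul, ← map_nsmul, ← ofMul_pow, hk, ofMul_one, map_zero]
  · rintro ⟨k, hk⟩
    have hpos : 0 < ℓ ^ k := pow_pos (Fact.out : ℓ.Prime).pos k
    have : NeZero (ℓ ^ k) := ⟨hpos.ne'⟩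
    have hex : ∀ n, ∃ ζ ∈ rootsOfUnity (ℓ ^ k) F,
        ProL.red ℓ n x = ProL.red ℓ n (toProL ℓ F (Additive.ofMul ζ)) := by
      intro n
      obtain ⟨a, ha⟩ := ProL.exists_red_eq (n + k) x
      have h0 := congrArg (ProL.red ℓ (n + k)) hk
      rw [← Nat.cast_pow, Nat.cast_smul_eq_nsmul, map_nsmul, ha, ← map_nsmul, ← map_nsmul,
        map_zero, ProL.red_toProL_eq_zero_iff] at h0
      obtain ⟨z, hz⟩ := h0
      rw [toMul_nsmul] at hz
      refine ⟨a.toMul * (z ^ ℓ ^ n)⁻¹, ?_, ?_⟩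
      · rw [mem_rootsOfUnity, mul_pow, hz, inv_pow, ← pow_mul, ← pow_add, mul_inv_cancel]
      · rw [ProL.red_eq_of_le (Nat.le_add_right n k) ha, ProL.red_toProL_eq_iff]
        exact ⟨z, by simp⟩
    have := Fintype.ofFinite (rootsOfUnity (ℓ ^ k) F)
    by_contra hx
    have hbad : ∀ ζ : rootsOfUnity (ℓ ^ k) F, ∃ n,
        ProL.red ℓ n x ≠ ProL.red ℓ n (toProL ℓ F (Additive.ofMul (ζ : Fˣ))) := by
      intro ζ
      by_contra! h
      exact hx ⟨ζ, ⟨k, (mem_rootsOfUnity _ _).1 ζ.2⟩, ProL.ext h⟩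
    choose N hN using hbad
    obtain ⟨ζ, hζ, h⟩ := hex (Finset.univ.sup N)
    exact hN ⟨ζ, hζ⟩ (ProL.red_eq_of_le (Finset.le_sup (Finset.mem_univ _)) h)

/-- If `E/F` is finite, then `lim F^×/F^{×ℓⁿ} → lim E^×/E^{×ℓⁿ}` reflects torsion: the norm is an
inverse up to the degree. -/
theorem mem_muProL_of_map {E : Type*} [Field E] [Algebra F E] [FiniteDimensional F E]
    {x : ProL ℓ F} (h : ProL.map ℓ (algebraMap F E) x ∈ muProL ℓ E) : x ∈ muProL ℓ F := by
  obtain ⟨k, hk⟩ := mem_muProL_iff.1 h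
  rw [← map_smul] at hk
  set y := (ℓ : ℤ_[ℓ]) ^ k • x with hy
  have hd : Module.finrank F E • y = 0 := by
    refine ProL.ext fun n => ?_
    obtain ⟨a, ha⟩ := ProL.exists_red_eq n y
    have h0 := ProL.red_map n (algebraMap F E) ha
    rw [hk, map_zero, eq_comm, ProL.red_toProL_eq_zero_iff] at h0
    obtain ⟨z, hz⟩ := h0
    rw [map_nsmul, ha, ← map_nsmul, ← map_nsmul, map_zero, ProL.red_toProL_eq_zero_iff]
    refine ⟨Units.map (Algebra.norm F) z, ?_⟩
    rw [← map_pow, ← hz]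
    ext
    exact (Algebra.norm_algebraMap (S := E) (a.toMul : F)).symm
  rw [← Nat.cast_smul_eq_nsmul ℤ_[ℓ]] at hd
  obtain ⟨j, hj⟩ := exists_pow_smul_eq_zero
    (Nat.cast_ne_zero.2 (Module.finrank_pos (R := F) (M := E)).ne') hd
  exact mem_muProL_iff.2 ⟨j + k, by rw [pow_add, mul_smul, ← hy, hj]⟩

end ProL

/-! ### Tensor products with the flat `ℤ`-module `ℤ_ℓ` -/

section Flatness

variable {ℓ : ℕ} [Fact ℓ.Prime] {A B : Type*} [AddCommGroup A] [AddCommGroup B]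

lemma exists_one_tmul_of_pow_smul_eq_zero_left {k : ℕ} (hA : ∀ a : A, ℓ ^ k • a = 0)
    (x : ℤ_[ℓ] ⊗[ℤ] A) : ∃ a : A, x = 1 ⊗ₜ a := by
  induction x using TensorProduct.induction_on with
  | zero => exact ⟨0, by rw [TensorProduct.tmul_zero]⟩
  | add x y hx hy =>
    obtain ⟨a, rfl⟩ := hx
    obtain ⟨b, rfl⟩ := hy
    exact ⟨a + b, by rw [TensorProduct.tmul_add]⟩
  | tmul c a =>
    obtain ⟨b, hb⟩ := exists_eq_appr_add k c
    refine ⟨c.appr k • a, ?_⟩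
    have h1 : ((ℓ : ℤ_[ℓ]) ^ k * b) ⊗ₜ[ℤ] a = 0 := by
      rw [← Nat.cast_pow, ← nsmul_eq_mul, TensorProduct.smul_tmul, hA, TensorProduct.tmul_zero]
    have h2 : (c.appr k : ℤ_[ℓ]) ⊗ₜ[ℤ] a = 1 ⊗ₜ (c.appr k • a) := by
      rw [← TensorProduct.smul_tmul, nsmul_one]
    conv_lhs => rw [hb, TensorProduct.add_tmul, h1, add_zero, h2]

/-- By flatness, the `ℓᵏ`-torsion of `ℤ_ℓ ⊗ A` comes from that of `A`. -/
theorem exists_one_tmul_of_pow_smul_eq_zero {k : ℕ} {x : ℤ_[ℓ] ⊗[ℤ] A}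
    (hx : (ℓ : ℤ_[ℓ]) ^ k • x = 0) : ∃ a : A, ℓ ^ k • a = 0 ∧ x = 1 ⊗ₜ a := by
  let m : A →ₗ[ℤ] A := (ℓ ^ k : ℕ) • LinearMap.id
  have hex : Function.Exact (LinearMap.ker m).subtype m := LinearMap.exact_subtype_ker_map m
  have h0 : LinearMap.lTensor ℤ_[ℓ] m x = 0 := by
    have hm : LinearMap.lTensor ℤ_[ℓ] m = (ℓ ^ k : ℕ) • LinearMap.id :=
      TensorProduct.ext' fun c a => TensorProduct.tmul_smul (ℓ ^ k : ℕ) c a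
    rw [hm, LinearMap.smul_apply, LinearMap.id_apply, ← Nat.cast_smul_eq_nsmul ℤ_[ℓ],
      Nat.cast_pow, hx]
  obtain ⟨y, rfl⟩ := (Module.Flat.lTensor_exact ℤ_[ℓ] hex x).1 h0
  obtain ⟨a, rfl⟩ := exists_one_tmul_of_pow_smul_eq_zero_left (ℓ := ℓ) (k := k)
    (fun a : LinearMap.ker m => Subtype.ext a.2) y
  exact ⟨a, a.2, LinearMap.lTensor_tmul _ _ _ _⟩

/-- By flatness, the `ℓ`-power torsion of `A` embeds in `ℤ_ℓ ⊗ A`. -/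
theorem eq_zero_of_one_tmul_eq_zero {k : ℕ} {a : A} (ha : ℓ ^ k • a = 0)
    (h : (1 : ℤ_[ℓ]) ⊗ₜ[ℤ] a = 0) : a = 0 := by
  let m : A →ₗ[ℤ] A := (ℓ ^ k : ℕ) • LinearMap.id
  let _ : Module (ZMod (ℓ ^ k)) (LinearMap.ker m) :=
    AddCommGroup.zmodModule (fun a : LinearMap.ker m => Subtype.ext a.2)
  have hinj := Module.Flat.lTensor_preserves_injective_linearMap (M := ℤ_[ℓ])
    (LinearMap.ker m).subtype Subtype.val_injective
  have h1 : (1 : ℤ_[ℓ]) ⊗ₜ[ℤ] (⟨a, ha⟩ : LinearMap.ker m) = 0 := by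
    apply hinj
    rw [LinearMap.lTensor_tmul, map_zero]
    exact h
  let φ : ℤ_[ℓ] ⊗[ℤ] LinearMap.ker m →+ LinearMap.ker m :=
    TensorProduct.liftAddHom
      ((smulAddHom (ZMod (ℓ ^ k)) (LinearMap.ker m)).comp
        (PadicInt.toZModPow (p := ℓ) k).toAddMonoidHom)
      (fun r c b => by
        change PadicInt.toZModPow k (r • c) • b = PadicInt.toZModPow k c • r • b
        rw [map_zsmul, zsmul_eq_mul, mul_comm, mul_smul, Int.cast_smul_eq_zsmul])
  have h2 := congrArg φ h1
  rw [map_zero, TensorProduct.liftAddHom_tmul] at h2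
  simpa [Subtype.ext_iff] using h2

/-- If a subgroup is cut out by finitely many endomorphisms, then so is its image after tensoring
with `ℤ_ℓ`. -/
theorem exists_baseChange_eq_of_forall {ι : Type*} [Finite ι] (f : A →ₗ[ℤ] B) (g : ι → B →ₗ[ℤ] B)
    (h : ∀ b, (∀ i, g i b = 0) → ∃ a, f a = b) (h' : ∀ i a, g i (f a) = 0) {x : ℤ_[ℓ] ⊗[ℤ] B}
    (hx : ∀ i, (g i).baseChange ℤ_[ℓ] x = 0) : ∃ y, f.baseChange ℤ_[ℓ] y = x := by
  classical
  have := Fintype.ofFinite ι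
  have hex : Function.Exact f (LinearMap.pi g) := fun b =>
    ⟨fun hb => h b fun i => congrFun hb i, by rintro ⟨a, rfl⟩; exact funext fun i => h' i a⟩
  refine (Module.Flat.lTensor_exact ℤ_[ℓ] hex x).1 ?_
  apply (TensorProduct.piRight ℤ ℤ ℤ_[ℓ] (fun _ : ι => B)).injective
  rw [map_zero]
  funext i
  rw [Pi.zero_apply, ← hx i]
  clear hx
  induction x using TensorProduct.induction_on with
  | zero => simp
  | add x y hx hy => rw [map_add, map_add, Pi.add_apply, hx, hy, map_add]
  | tmul c b => simp

/-- If a subgroup is cut out by a locally finite family of homomorphisms to `ℤ`, then so is its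
image after tensoring with `ℤ_ℓ`. -/
theorem exists_baseChange_eq_of_forall_int {ι : Type*} (f : A →ₗ[ℤ] B) (g : B →ₗ[ℤ] ι →₀ ℤ)
    (h : ∀ b, g b = 0 → ∃ a, f a = b) (h' : ∀ a, g (f a) = 0) {x : ℤ_[ℓ] ⊗[ℤ] B}
    (hx : ∀ i, LinearMap.liftBaseChange ℤ_[ℓ]
      ((Algebra.linearMap ℤ ℤ_[ℓ]).comp ((Finsupp.lapply i).comp g)) x = 0) :
    ∃ y, f.baseChange ℤ_[ℓ] y = x := by
  classical
  have hex : Function.Exact f g := fun b => ⟨h b, by rintro ⟨a, rfl⟩; exact h' a⟩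
  refine (Module.Flat.lTensor_exact ℤ_[ℓ] hex x).1 ?_
  apply (TensorProduct.finsuppScalarRight ℤ ℤ ℤ_[ℓ] ι).injective
  rw [map_zero]
  ext1 i
  rw [Finsupp.zero_apply, ← hx i]
  clear hx
  induction x using TensorProduct.induction_on with
  | zero => simp
  | add x y hx hy => rw [map_add, map_add, Finsupp.add_apply, hx, hy, map_add]
  | tmul c b => simp [TensorProduct.finsuppScalarRight_apply_tmul_apply, mul_comm]

theorem baseChange_injective {f : A →ₗ[ℤ] B} (hf : Function.Injective f) :
    Function.Injective (f.baseChange ℤ_[ℓ]) :=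
  Module.Flat.lTensor_preserves_injective_linearMap (M := ℤ_[ℓ]) f hf

end Flatness

/-! ### The cyclotomic `ℤ_ℓ`-extension and roots of unity -/

section Cyclotomic

open IntermediateField

variable {ℓ : ℕ}

lemma ratCyclotomic_le :
    ratCyclotomic ℓ ≤ adjoin ℚ {ζ : AlgebraicClosure ℚ | ∃ n : ℕ, ζ ^ ℓ ^ n = 1} :=
  iSup₂_le fun _ hE => hE.1

variable [Fact ℓ.Prime]

/-- The field of `ℓⁿ⁺¹`-th roots of unity is the compositum of its subfield of degree `ℓⁿ` and of
the field of `ℓ`-th roots of unity, because the degrees `ℓⁿ` and `ℓ - 1` are coprime. -/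
theorem exists_finrank_eq_and_mem_sup (hℓ : ℓ ≠ 2) {k Ω : Type*} [Field k] [Field Ω] [Algebra k Ω]
    [Algebra.IsAlgebraic k Ω] (hirr : ∀ n, 0 < n → Irreducible (Polynomial.cyclotomic n k))
    {N : ℕ} {P : Ω} (hP : IsPrimitiveRoot P (ℓ ^ (N + 1))) :
    ∃ E ≤ k⟮P⟯, Module.finrank k E = ℓ ^ N ∧ P ∈ E ⊔ k⟮P ^ ℓ ^ N⟯ := by
  have hp : ℓ.Prime := Fact.out
  have hpos : 0 < ℓ ^ (N + 1) := pow_pos hp.pos _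
  have : NeZero (ℓ ^ (N + 1)) := ⟨hpos.ne'⟩
  have : NeZero ℓ := ⟨hp.ne_zero⟩
  have hcyc := hP.intermediateField_adjoin_isCyclotomicExtension k
  have : FiniteDimensional k k⟮P⟯ := IsCyclotomicExtension.finiteDimensional {ℓ ^ (N + 1)} k _
  have : IsGalois k k⟮P⟯ := IsCyclotomicExtension.isGalois {ℓ ^ (N + 1)} k _
  have hdeg : Module.finrank k k⟮P⟯ = ℓ ^ N * (ℓ - 1) := by
    rw [IsCyclotomicExtension.finrank k⟮P⟯ (hirr _ hpos),
      Nat.totient_prime_pow_succ hp]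
  have hQ : IsPrimitiveRoot (P ^ ℓ ^ N) ℓ := hP.pow hpos (pow_succ ℓ N)
  have hcyc' := hQ.intermediateField_adjoin_isCyclotomicExtension k
  have hdeg' : Module.finrank k k⟮P ^ ℓ ^ N⟯ = ℓ - 1 := by
    rw [IsCyclotomicExtension.finrank k⟮P ^ ℓ ^ N⟯
      (hirr _ hp.pos), Nat.totient_prime hp]
  -- the fixed field of the subgroup of order `ℓ - 1` of the cyclic group `(ℤ/ℓⁿ⁺¹)^×`
  have : IsCyclic Gal(k⟮P⟯/k) :=
    have := ZMod.isCyclic_units_of_prime_pow ℓ hp hℓ (N + 1)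
    isCyclic_of_injective
      (IsCyclotomicExtension.autEquivPow k⟮P⟯
        (hirr _ hpos)).toMonoidHom (MulEquiv.injective _)
  obtain ⟨γ, hγ⟩ := IsCyclic.exists_ofOrder_eq_natCard (α := Gal(k⟮P⟯/k))
  rw [IsGalois.card_aut_eq_finrank, hdeg] at hγ
  let E := fixedField (Subgroup.zpowers (γ ^ ℓ ^ N))
  have hE : Module.finrank k E = ℓ ^ N := by
    have h1 := finrank_fixedField_eq_card (Subgroup.zpowers (γ ^ ℓ ^ N))
    have hl : 0 < ℓ - 1 := Nat.sub_pos_of_lt hp.one_lt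
    rw [Nat.card_zpowers, orderOf_pow_of_dvd (pow_ne_zero _ hp.ne_zero) (hγ ▸ dvd_mul_right _ _),
      hγ, Nat.mul_div_cancel_left _ (pow_pos hp.pos _)] at h1
    have h2 := Module.finrank_mul_finrank k E k⟮P⟯
    rw [h1, hdeg] at h2
    exact Nat.eq_of_mul_eq_mul_right hl h2
  have hE' : Module.finrank k (lift E) = ℓ ^ N := by
    rw [← hE]
    exact (liftAlgEquiv E).toLinearEquiv.finrank_eq.symm
  have hle : lift E ⊔ k⟮P ^ ℓ ^ N⟯ ≤ k⟮P⟯ :=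
    sup_le (lift_le E) (adjoin_simple_le_iff.2 (pow_mem (mem_adjoin_simple_self k P) _))
  have : FiniteDimensional k (lift E ⊔ k⟮P ^ ℓ ^ N⟯ : IntermediateField k Ω) :=
    .of_injective (inclusion hle).toLinearMap (inclusion hle).injective
  have heq : lift E ⊔ k⟮P ^ ℓ ^ N⟯ = k⟮P⟯ := by
    refine eq_of_le_of_finrank_le hle ?_
    rw [hdeg]
    refine Nat.le_of_dvd Module.finrank_pos (Nat.Coprime.mul_dvd_of_dvd_of_dvd ?_ ?_ ?_)
    · exact Nat.Coprime.pow_left _ ((Nat.coprime_self_sub_right hp.one_le).2 (Nat.coprime_one_right ℓ))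
    · rw [← hE']
      exact finrank_dvd_of_le_right le_sup_left
    · rw [← hdeg']
      exact finrank_dvd_of_le_right le_sup_right
  exact ⟨lift E, lift_le E, hE', by rw [heq]; exact mem_adjoin_simple_self k P⟩

lemma mem_ratCyclotomic_sup (hℓ : ℓ ≠ 2) {N : ℕ} {P : AlgebraicClosure ℚ}
    (hP : IsPrimitiveRoot P (ℓ ^ (N + 1))) : P ∈ ratCyclotomic ℓ ⊔ ℚ⟮P ^ ℓ ^ N⟯ := by
  have : Algebra.IsAlgebraic ℚ (AlgebraicClosure ℚ) := AlgebraicClosure.isAlgebraic ℚ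
  obtain ⟨E, hE, hdeg, hmem⟩ := exists_finrank_eq_and_mem_sup hℓ
    (fun n hn => Polynomial.cyclotomic.irreducible_rat hn) hP
  have hle : E ≤ ratCyclotomic ℓ := by
    refine le_iSup₂_of_le E ⟨hE.trans ?_, N, hdeg⟩ le_rfl
    rw [adjoin_simple_le_iff]
    exact subset_adjoin _ _ ⟨N + 1, hP.pow_eq_one⟩
  exact sup_le_sup_right hle _ hmem

variable {F Ω : Type*} [Field F] [CharZero F] [Field Ω] [IsAlgClosed Ω] [Algebra F Ω]

omit [CharZero F] [IsAlgClosed Ω] [Fact ℓ.Prime] in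
/-- The cyclotomic `ℤ_ℓ`-extension is stable under all embeddings. -/
lemma map_mem_cyclotomic (σ : Ω →ₐ[F] Ω) {x : Ω} (hx : x ∈ cyclotomic ℓ F Ω) :
    σ x ∈ cyclotomic ℓ F Ω := by
  have h : cyclotomic ℓ F Ω ≤ (cyclotomic ℓ F Ω).comap σ := by
    refine adjoin_le_iff.2 ?_
    rintro _ ⟨φ, y, rfl⟩
    exact subset_adjoin F _ ⟨(σ : Ω →+* Ω).comp φ, y, rfl⟩
  exact h hx

omit [Fact ℓ.Prime] in
lemma cyclotomic_le :
    cyclotomic ℓ F Ω ≤ adjoin F {ζ : Ω | ∃ n : ℕ, ζ ^ ℓ ^ n = 1} := by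
  have : CharZero Ω := charZero_of_injective_algebraMap (algebraMap F Ω).injective
  have : Algebra.IsAlgebraic ℚ (AlgebraicClosure ℚ) := AlgebraicClosure.isAlgebraic ℚ
  refine adjoin_le_iff.2 ?_
  rintro _ ⟨φ, y, rfl⟩
  let _ : Algebra (ratCyclotomic ℓ) Ω := φ.toAlgebra
  have : Algebra.IsAlgebraic (ratCyclotomic ℓ) (AlgebraicClosure ℚ) :=
    Algebra.IsAlgebraic.tower_top (K := ℚ) _
  let ψ : AlgebraicClosure ℚ →ₐ[ratCyclotomic ℓ] Ω := IsAlgClosed.lift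
  have hψ : φ y = ψ (y : AlgebraicClosure ℚ) := (ψ.commutes y).symm
  have h : adjoin ℚ {ζ : AlgebraicClosure ℚ | ∃ n : ℕ, ζ ^ ℓ ^ n = 1} ≤
      ((adjoin F {ζ : Ω | ∃ n : ℕ, ζ ^ ℓ ^ n = 1}).toSubfield.comap
        (ψ : AlgebraicClosure ℚ →+* Ω)).toIntermediateField fun q => by
          rw [Subfield.mem_comap, eq_ratCast, map_ratCast]
          exact SubfieldClass.ratCast_mem _ q := by
    refine adjoin_le_iff.2 ?_
    rintro ζ ⟨n, hn⟩
    exact subset_adjoin F _ ⟨n, by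
      change ψ ζ ^ ℓ ^ n = 1
      rw [← map_pow, hn, map_one]⟩
  rw [hψ]
  exact h (ratCyclotomic_le y.2)

/-- If `F` contains the `ℓ`-th roots of unity, its cyclotomic `ℤ_ℓ`-extension contains all roots of
unity of `ℓ`-power order. -/
theorem mem_cyclotomic_of_pow_eq_one (hℓ : ℓ ≠ 2) {ζ₁ : F} (hζ₁ : IsPrimitiveRoot ζ₁ ℓ) {ζ : Ω}
    {n : ℕ} (hζ : ζ ^ ℓ ^ n = 1) : ζ ∈ cyclotomic ℓ F Ω := by
  have hp : ℓ.Prime := Fact.out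
  have : NeZero ℓ := ⟨hp.ne_zero⟩
  have : CharZero Ω := charZero_of_injective_algebraMap (algebraMap F Ω).injective
  have : Algebra.IsAlgebraic ℚ (AlgebraicClosure ℚ) := AlgebraicClosure.isAlgebraic ℚ
  let ψ : AlgebraicClosure ℚ →ₐ[ℚ] Ω := IsAlgClosed.lift
  have : NeZero (ℓ ^ (n + 1)) := ⟨pow_ne_zero _ hp.ne_zero⟩
  have : NeZero ((ℓ ^ (n + 1) : ℕ) : AlgebraicClosure ℚ) := ⟨Nat.cast_ne_zero.2 (NeZero.ne _)⟩
  obtain ⟨P, hP⟩ := HasEnoughRootsOfUnity.exists_primitiveRoot (AlgebraicClosure ℚ) (ℓ ^ (n + 1))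
  have hψP : IsPrimitiveRoot (ψ P) (ℓ ^ (n + 1)) := hP.map_of_injective ψ.injective
  obtain ⟨i, -, rfl⟩ := hψP.eq_pow_of_pow_eq_one
    (show ζ ^ ℓ ^ (n + 1) = 1 by rw [pow_succ, pow_mul, hζ, one_pow])
  refine pow_mem ?_ i
  have h : ratCyclotomic ℓ ⊔ ℚ⟮P ^ ℓ ^ n⟯ ≤
      ((cyclotomic ℓ F Ω).toSubfield.comap
        (ψ : AlgebraicClosure ℚ →+* Ω)).toIntermediateField fun q => by
          rw [Subfield.mem_comap, eq_ratCast, map_ratCast]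
          exact SubfieldClass.ratCast_mem _ q := by
    refine sup_le (fun y hy => ?_) (adjoin_simple_le_iff.2 ?_)
    · exact subset_adjoin F _ ⟨(ψ : AlgebraicClosure ℚ →+* Ω).comp
        (ratCyclotomic ℓ).val.toRingHom, ⟨y, hy⟩, rfl⟩
    · obtain ⟨j, -, hj⟩ := (hζ₁.map_of_injective (algebraMap F Ω).injective).eq_pow_of_pow_eq_one
        (show ψ (P ^ ℓ ^ n) ^ ℓ = 1 by
          rw [← map_pow, ← pow_mul, ← pow_succ, hP.pow_eq_one, map_one])
      change ψ (P ^ ℓ ^ n) ∈ cyclotomic ℓ F Ω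
      rw [← hj, ← map_pow]
      exact IntermediateField.algebraMap_mem _ _
  exact h (mem_ratCyclotomic_sup hℓ hP)

/-- An `ℓ`-extension `L/K` which is linearly disjoint from the cyclotomic `ℤ_ℓ`-extension contains
no new root of unity of `ℓ`-power order: its `ℓ`-th roots of unity have degree less than `ℓ` over
`K`, hence lie in `K`, and then the other ones lie in the cyclotomic `ℤ_ℓ`-extension. -/
theorem exists_algebraMap_eq_of_pow_eq_one (hℓ : ℓ ≠ 2) {K L : Type*} [Field K] [CharZero K]
    [Field L] [Algebra K L] [FiniteDimensional K L] (hdeg : ∃ d, Module.finrank K L = ℓ ^ d)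
    [Algebra L Ω] [Algebra K Ω] [IsScalarTower K L Ω]
    (hdisj : (cyclotomic ℓ K Ω).LinearDisjoint L) {ζ : L} {n : ℕ} (hζ : ζ ^ ℓ ^ n = 1) :
    ∃ ξ : K, algebraMap K L ξ = ζ := by
  have hp : ℓ.Prime := Fact.out
  rcases eq_or_ne ζ 1 with rfl | hne
  · exact ⟨1, map_one _⟩
  obtain ⟨m, hm⟩ : ∃ m, orderOf ζ = ℓ ^ (m + 1) := by
    obtain ⟨m, -, hm⟩ := (Nat.dvd_prime_pow hp).1 (orderOf_dvd_of_pow_eq_one hζ)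
    cases m with
    | zero => exact absurd (orderOf_eq_one_iff.1 (by simpa using hm)) hne
    | succ m => exact ⟨m, hm⟩
  have hprim : IsPrimitiveRoot (ζ ^ ℓ ^ m) ℓ :=
    (hm ▸ IsPrimitiveRoot.orderOf ζ).pow (pow_pos hp.pos _) (pow_succ ℓ m)
  have hint : IsIntegral K (ζ ^ ℓ ^ m) := Algebra.IsIntegral.isIntegral _
  have h1 : Module.finrank K K⟮ζ ^ ℓ ^ m⟯ = 1 := by
    obtain ⟨d, hd⟩ := hdeg
    have hdvd : Module.finrank K K⟮ζ ^ ℓ ^ m⟯ ∣ ℓ ^ d :=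
      hd ▸ Dvd.intro _ (Module.finrank_mul_finrank K K⟮ζ ^ ℓ ^ m⟯ L)
    obtain ⟨e, -, he⟩ := (Nat.dvd_prime_pow hp).1 hdvd
    have hlt : Module.finrank K K⟮ζ ^ ℓ ^ m⟯ < ℓ := by
      rw [adjoin.finrank hint]
      have h0 : Polynomial.cyclotomic ℓ K ≠ 0 := Polynomial.cyclotomic_ne_zero _ _
      have := Polynomial.natDegree_le_of_dvd (minpoly.dvd K (ζ ^ ℓ ^ m)
        (p := Polynomial.cyclotomic ℓ K) (by
          rw [Polynomial.aeval_def, ← Polynomial.eval_map, Polynomial.map_cyclotomic]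
          exact hprim.isRoot_cyclotomic hp.pos)) h0
      rw [Polynomial.natDegree_cyclotomic, Nat.totient_prime hp] at this
      have := hp.one_lt
      omega
    cases e with
    | zero => simpa using he
    | succ e =>
      rw [he, pow_succ] at hlt
      exact absurd hlt (not_lt.2 (Nat.le_mul_of_pos_left _ (pow_pos hp.pos _)))
  rw [finrank_adjoin_simple_eq_one_iff, mem_bot] at h1
  obtain ⟨ζ₁, hζ₁⟩ := h1
  have hζ₁' : IsPrimitiveRoot ζ₁ ℓ :=
    IsPrimitiveRoot.of_map_of_injective (f := algebraMap K L) (hζ₁ ▸ hprim)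
      (algebraMap K L).injective
  have hmem : algebraMap L Ω ζ ∈ cyclotomic ℓ K Ω :=
    mem_cyclotomic_of_pow_eq_one hℓ hζ₁' (n := n) (by rw [← map_pow, hζ, map_one])
  have hbot := Subalgebra.LinearDisjoint.inf_eq_bot hdisj
  obtain ⟨ξ, hξ⟩ := Algebra.mem_bot.1 (hbot ▸ Algebra.mem_inf.2 ⟨hmem, ζ, rfl⟩ :
    algebraMap L Ω ζ ∈ (⊥ : Subalgebra K Ω))
  refine ⟨ξ, (algebraMap L Ω).injective ?_⟩
  rw [← hξ, IsScalarTower.algebraMap_apply K L Ω]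

end Cyclotomic

/-! ### Kummer theory of the cyclotomic `ℤ_ℓ`-extension -/

section Kummer

open IntermediateField

variable {ℓ : ℕ} [Fact ℓ.Prime]

/-- Let `E = F(ζ)` be cyclic over `F`, with `ζ` of order `ℓᴺ`, and assume that `F` does not contain
the `ℓ^{N-n+1}`-th roots of unity. An element `x` of `E` with `x^{ℓⁿ} ∈ F` is the product of a power
of `ζ` and of an element of `F`: for a generator `γ` of the Galois group, every `ℓⁿ`-th root of unity
is of the form `γ ξ / ξ` with `ξ` a power of `ζ`. -/
theorem exists_eq_pow_mul_algebraMap {F E : Type*} [Field F] [Field E] [Algebra F E]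
    [FiniteDimensional F E] [IsGalois F E] {γ : Gal(E/F)} (hγ : ∀ σ, σ ∈ Subgroup.zpowers γ)
    {n N : ℕ} (hn : 0 < n) (hnN : n ≤ N) {ζ : E} (hζ : IsPrimitiveRoot ζ (ℓ ^ N))
    (hζF : ζ ^ ℓ ^ (n - 1) ∉ Set.range (algebraMap F E)) {x : E} (hx0 : x ≠ 0)
    (hx : x ^ ℓ ^ n ∈ Set.range (algebraMap F E)) :
    ∃ (i : ℕ) (b : F), x = ζ ^ i * algebraMap F E b := by
  have hp : ℓ.Prime := Fact.out
  have hfix : ∀ y : E, γ y = y → y ∈ Set.range (algebraMap F E) := by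
    intro y hy
    refine (IsGalois.mem_bot_iff_fixed (F := F) y).2 fun σ => ?_
    have hle : Subgroup.zpowers γ ≤ MulAction.stabilizer Gal(E/F) y :=
      Subgroup.zpowers_le.2 hy
    exact hle (hγ σ)
  have hNn : ℓ ^ N = ℓ ^ (N - n) * ℓ ^ n := by rw [← pow_add, Nat.sub_add_cancel hnN]
  have : NeZero (ℓ ^ N) := ⟨pow_ne_zero _ hp.ne_zero⟩
  have : NeZero (ℓ ^ n) := ⟨pow_ne_zero _ hp.ne_zero⟩
  have hζ0 : ζ ≠ 0 := hζ.ne_zero (NeZero.ne _)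
  -- `γ x = ζ^{ℓ^{N-n} j} x`
  have hε : (γ x / x) ^ ℓ ^ n = 1 := by
    obtain ⟨a, ha⟩ := hx
    rw [div_pow, ← map_pow, ← ha, AlgEquiv.commutes, div_self]
    rw [ha]
    exact pow_ne_zero _ hx0
  obtain ⟨j, -, hj⟩ := (hζ.pow (NeZero.pos _) hNn).eq_pow_of_pow_eq_one hε
  -- `γ ζ = ζ^{r + 1}`
  obtain ⟨r, hr⟩ : ∃ r, γ ζ / ζ = ζ ^ r := by
    obtain ⟨r, -, hr⟩ := hζ.eq_pow_of_pow_eq_one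
      (show (γ ζ / ζ) ^ ℓ ^ N = 1 by rw [div_pow, ← map_pow, hζ.pow_eq_one, map_one, div_one])
    exact ⟨r, hr.symm⟩
  have hγζ : γ ζ = ζ ^ r * ζ := by rw [← hr, div_mul_cancel₀ _ hζ0]
  have hndvd : ¬ ℓ ^ (N - n + 1) ∣ r := by
    rintro ⟨c, rfl⟩
    refine hζF (hfix _ ?_)
    rw [map_pow, hγζ, mul_pow, ← pow_mul]
    have : ℓ ^ (N - n + 1) * c * ℓ ^ (n - 1) = ℓ ^ N * c := by
      rw [mul_right_comm, ← pow_add]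
      congr 2
      omega
    rw [this, pow_mul, hζ.pow_eq_one, one_pow, one_mul]
  have hr0 : r ≠ 0 := by rintro rfl; exact hndvd (dvd_zero _)
  obtain ⟨s, u, hu, hsu⟩ := Nat.exists_eq_pow_mul_and_not_dvd hr0 ℓ hp.ne_one
  have hs : s ≤ N - n := by
    by_contra! h
    exact hndvd (hsu ▸ (pow_dvd_pow ℓ h).trans (dvd_mul_right _ _))
  -- choose `i` with `i r ≡ ℓ^{N-n} j` modulo `ℓᴺ`
  obtain ⟨u', hu'⟩ : ∃ u', u * u' ≡ 1 [MOD ℓ ^ N] := by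
    have h1 : 1 < ℓ ^ N := Nat.one_lt_pow (by omega) hp.one_lt
    obtain ⟨u', -, hu'⟩ := Nat.exists_mul_mod_eq_one_of_coprime
      (((Nat.Prime.coprime_iff_not_dvd hp).2 hu).symm.pow_right N) h1
    exact ⟨u', hu'.trans (Nat.mod_eq_of_lt h1).symm⟩
  let i := ℓ ^ (N - n - s) * u' * j
  have hi : ζ ^ (r * i) = ζ ^ (ℓ ^ (N - n) * j) := by
    refine pow_eq_pow_of_modEq ?_ hζ.pow_eq_one
    have : r * i = u * u' * (ℓ ^ (N - n) * j) := by
      have h1 : ℓ ^ (N - n) = ℓ ^ s * ℓ ^ (N - n - s) := by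
        rw [← pow_add, Nat.add_sub_cancel' hs]
      simp only [i]
      rw [h1, hsu]
      ring
    rw [this]
    simpa using hu'.mul_right (ℓ ^ (N - n) * j)
  obtain ⟨b, hb⟩ := hfix (x / ζ ^ i) (by
    have hγx : γ x = ζ ^ (ℓ ^ (N - n) * j) * x := by
      rw [pow_mul, hj, div_mul_cancel₀ _ hx0]
    rw [map_div₀, map_pow, hγζ, hγx, mul_pow, ← pow_mul, hi,
      mul_div_mul_left _ _ (pow_ne_zero _ hζ0)])
  exact ⟨i, b, by rw [hb, mul_div_cancel₀ _ (pow_ne_zero _ hζ0)]⟩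

variable {F Ω : Type*} [Field F] [CharZero F] [Field Ω] [IsAlgClosed Ω] [Algebra F Ω]

/-- Let `F` contain the `ℓⁿ`-th roots of unity, with `n > 0`. The Kummer extension of `F` generated
by an `ℓⁿ`-th root of `a` is contained in the cyclotomic `ℤ_ℓ`-extension if and only if `a` is the
product of a root of unity and of an `ℓⁿ`-th power. -/
theorem mem_cyclotomic_iff [Algebra.IsAlgebraic F Ω] (hℓ : ℓ ≠ 2) {n : ℕ} (hn : 0 < n) {ζ₀ : F}
    (hζ₀ : IsPrimitiveRoot ζ₀ (ℓ ^ n)) {x : Ω} {a : Fˣ} (hx : x ^ ℓ ^ n = algebraMap F Ω a) :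
    x ∈ cyclotomic ℓ F Ω ↔ ∃ ξ ∈ mu ℓ F, ∃ b : Fˣ, a = ξ * b ^ ℓ ^ n := by
  have hp : ℓ.Prime := Fact.out
  have hx0 : x ≠ 0 := by
    rintro rfl
    rw [zero_pow (pow_ne_zero _ hp.ne_zero), eq_comm, map_eq_zero] at hx
    exact a.ne_zero hx
  constructor
  · intro hmem
    have hmem' := cyclotomic_le hmem
    by_cases hall : ∀ ζ : Ω, (∃ n : ℕ, ζ ^ ℓ ^ n = 1) → ζ ∈ Set.range (algebraMap F Ω)
    · have hbot : adjoin F {ζ : Ω | ∃ n : ℕ, ζ ^ ℓ ^ n = 1} ≤ ⊥ :=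
        adjoin_le_iff.2 fun ζ hζ => mem_bot.2 (hall ζ hζ)
      obtain ⟨b, rfl⟩ := mem_bot.1 (hbot hmem')
      refine ⟨1, one_mem _, Units.mk0 b fun h => hx0 (by rw [h, map_zero]), ?_⟩
      rw [← map_pow] at hx
      ext
      simpa using ((algebraMap F Ω).injective hx).symm
    push Not at hall
    obtain ⟨ζ', ⟨M, hM⟩, hζ'⟩ := hall
    obtain ⟨T, hT, hxT⟩ := exists_finset_of_mem_adjoin hmem'
    obtain ⟨N₀, hN₀⟩ : ∃ N₀, ∀ t ∈ T, t ^ ℓ ^ N₀ = 1 := by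
      choose! f hf using hT
      refine ⟨T.sup f, fun t ht => ?_⟩
      obtain ⟨c, hc⟩ := pow_dvd_pow ℓ (Finset.le_sup (f := f) ht)
      rw [hc, pow_mul, hf ht, one_pow]
    let N := N₀ + (M + n)
    have : CharZero Ω := charZero_of_injective_algebraMap (algebraMap F Ω).injective
    have hpos : 0 < ℓ ^ N := pow_pos hp.pos _
    have : NeZero (ℓ ^ N) := ⟨hpos.ne'⟩
    have : NeZero ((ℓ ^ N : ℕ) : Ω) := ⟨Nat.cast_ne_zero.2 (NeZero.ne _)⟩
    obtain ⟨P, hP⟩ := HasEnoughRootsOfUnity.exists_primitiveRoot Ω (ℓ ^ N)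
    have hcyc := hP.intermediateField_adjoin_isCyclotomicExtension F
    have : FiniteDimensional F F⟮P⟯ := IsCyclotomicExtension.finiteDimensional {ℓ ^ N} F _
    have : IsGalois F F⟮P⟯ := IsCyclotomicExtension.isGalois {ℓ ^ N} F _
    have hPmem := mem_adjoin_simple_self F P
    let P' : F⟮P⟯ := ⟨P, hPmem⟩
    have hP' : IsPrimitiveRoot P' (ℓ ^ N) :=
      IsPrimitiveRoot.of_map_of_injective (f := algebraMap F⟮P⟯ Ω) hP (algebraMap F⟮P⟯ Ω).injective
    have : IsCyclic Gal(F⟮P⟯/F) :=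
      have := ZMod.isCyclic_units_of_prime_pow ℓ hp hℓ N
      isCyclic_of_injective _ (IsPrimitiveRoot.autToPow_injective F hP')
    obtain ⟨γ, hγ⟩ := IsCyclic.exists_generator (α := Gal(F⟮P⟯/F))
    have hxP : x ∈ F⟮P⟯ := by
      refine (adjoin_le_iff.2 fun t ht => ?_ : adjoin F (T : Set Ω) ≤ F⟮P⟯) hxT
      obtain ⟨i, -, rfl⟩ := hP.eq_pow_of_pow_eq_one
        (show t ^ ℓ ^ N = 1 by rw [pow_add, pow_mul, hN₀ t ht, one_pow])
      exact pow_mem hPmem i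
    have hPF : P' ^ ℓ ^ (n - 1) ∉ Set.range (algebraMap F F⟮P⟯) := by
      rintro ⟨y, hy⟩
      have hprim : IsPrimitiveRoot (P ^ ℓ ^ (n - 1)) (ℓ ^ (N - (n - 1))) :=
        hP.pow hpos (by rw [← pow_add]; congr 1; omega)
      have : NeZero (ℓ ^ (N - (n - 1))) := ⟨pow_ne_zero _ hp.ne_zero⟩
      obtain ⟨i, -, hi⟩ := hprim.eq_pow_of_pow_eq_one (ξ := ζ') (by
        obtain ⟨c, hc⟩ := pow_dvd_pow ℓ (show M ≤ N - (n - 1) by omega)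
        rw [hc, pow_mul, hM, one_pow])
      refine hζ' ⟨y ^ i, ?_⟩
      rw [map_pow, ← hi]
      congr 1
      exact congrArg (algebraMap F⟮P⟯ Ω) hy
    obtain ⟨i, b, hb⟩ := exists_eq_pow_mul_algebraMap hγ hn (show n ≤ N by omega) hP' hPF
      (x := ⟨x, hxP⟩) (fun h => hx0 (congrArg Subtype.val h)) ⟨a, Subtype.ext hx.symm⟩
    have hb' : x = P ^ i * algebraMap F Ω b := congrArg (algebraMap F⟮P⟯ Ω) hb
    have hb0 : b ≠ 0 := by
      rintro rfl
      exact hx0 (by rw [hb', map_zero, mul_zero])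
    refine ⟨a / Units.mk0 b hb0 ^ ℓ ^ n, ⟨N, ?_⟩, Units.mk0 b hb0, (div_mul_cancel _ _).symm⟩
    rw [hb', mul_pow] at hx
    have hξ : algebraMap F Ω ((a : F) / b ^ ℓ ^ n) = (P ^ i) ^ ℓ ^ n := by
      have : algebraMap F Ω b ≠ 0 := by simpa using hb0
      rw [map_div₀, ← hx, map_pow, mul_div_cancel_right₀ _ (pow_ne_zero _ this)]
    ext
    apply (algebraMap F Ω).injective
    rw [Units.val_pow_eq_pow_val, Units.val_div_eq_div_val, Units.val_pow_eq_pow_val,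
      Units.val_mk0, map_pow, hξ, ← pow_mul, ← pow_mul, ← mul_assoc, mul_comm, pow_mul,
      hP.pow_eq_one, one_pow, Units.val_one, map_one]
  · rintro ⟨ξ, ⟨k, hk⟩, b, hb⟩
    have hb0 : algebraMap F Ω b ≠ 0 := by simp
    have h : (x / algebraMap F Ω b) ^ ℓ ^ (n + k) = 1 := by
      have h1 : (x / algebraMap F Ω b) ^ ℓ ^ n = algebraMap F Ω ξ := by
        rw [div_pow, hx, hb, Units.val_mul, map_mul, Units.val_pow_eq_pow_val, map_pow,
          mul_div_cancel_right₀ _ (pow_ne_zero _ hb0)]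
      rw [pow_add, pow_mul, h1, ← map_pow, ← Units.val_pow_eq_pow_val, hk, Units.val_one, map_one]
    have hζ₁ : IsPrimitiveRoot (ζ₀ ^ ℓ ^ (n - 1)) ℓ :=
      hζ₀.pow (pow_pos hp.pos _) (by rw [← pow_succ]; congr 1; omega)
    rw [← div_mul_cancel₀ x hb0]
    exact mul_mem (mem_cyclotomic_of_pow_eq_one hℓ hζ₁ h) (IntermediateField.algebraMap_mem _ _)

end Kummer

/-! ### The completions of a number field -/

section Local

open WithZero

variable {K : Type*} [Field K] [NumberField K] (v : HeightOneSpectrum (𝓞 K))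

instance charZero_adicCompletion : CharZero (v.adicCompletion K) :=
  charZero_of_injective_algebraMap (algebraMap K (v.adicCompletion K)).injective

lemma exists_forall_valued_sub_le_of_mem_nhds {s : Set (v.adicCompletion K)}
    {x : v.adicCompletion K} (hs : s ∈ nhds x) :
    ∃ M : ℕ, ∀ y, Valued.v (y - x) ≤ exp (-(M : ℤ)) → y ∈ s := by
  obtain ⟨γ, hγ⟩ := Valued.mem_nhds.1 hs
  have hg : MonoidWithZeroHom.ValueGroup₀.embedding (γ : MonoidWithZeroHom.ValueGroup₀
      (.ofClass (Valued.v : Valuation (v.adicCompletion K) (WithZero (Multiplicative ℤ))))) ≠ 0 := by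
    simp
  refine ⟨(-log (MonoidWithZeroHom.ValueGroup₀.embedding γ.1)).toNat + 1, fun y hy => hγ ?_⟩
  rw [Set.mem_ofPred_eq, Valuation.restrict_lt_iff_lt_embedding]
  refine hy.trans_lt ?_
  rw [← lt_log_iff_exp_lt hg]
  push_cast
  omega

lemma exists_valued_eq_exp (n : ℤ) : ∃ π : K, v.valuation K π = exp n :=
  v.valuation_surjective K _

lemma setOf_valued_sub_lt_mem_nhds (x : v.adicCompletion K) (n : ℤ) :
    {y | Valued.v (y - x) < exp n} ∈ nhds x := by
  obtain ⟨π, hπ⟩ := exists_valued_eq_exp v n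
  have hπ' : Valued.v (algebraMap K (v.adicCompletion K) π) = exp n :=
    (HeightOneSpectrum.valuedAdicCompletion_eq_valuation' v π).trans hπ
  refine Valued.mem_nhds.2 ⟨Units.mk0 (Valued.v.restrict (algebraMap K (v.adicCompletion K) π)) ?_,
    fun y hy => ?_⟩
  · intro h
    rw [Valuation.restrict_eq_zero_iff, hπ'] at h
    exact exp_ne_zero h
  · rw [Set.mem_ofPred_eq, Units.val_mk0, Valuation.restrict_lt_iff] at hy
    rwa [Set.mem_ofPred_eq, ← hπ']

open scoped Valued in
/-- A neighbourhood of `1` consists of `m`-th powers, since `x ↦ x ^ m` is a local homeomorphism. -/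
theorem exists_pow_eq_of_valued_sub_one_le {m : ℕ} (hm : m ≠ 0) :
    ∃ M : ℕ, ∀ x : v.adicCompletion K, Valued.v (x - 1) ≤ exp (-(M : ℤ)) → ∃ z, z ^ m = x := by
  have h := (hasStrictDerivAt_pow m (1 : v.adicCompletion K)).map_nhds_eq
    (by simpa using hm)
  have hr : Set.range (fun z : v.adicCompletion K => z ^ m) ∈ nhds (1 : v.adicCompletion K) := by
    rw [one_pow] at h
    rw [← h]
    exact Filter.range_mem_map
  exact exists_forall_valued_sub_le_of_mem_nhds v hr

lemma valued_algebraMap_unit (x : Kˣ) :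
    Valued.v (algebraMap K (v.adicCompletion K) x) = exp (-ord v x) := by
  rw [exp_neg_ord]
  exact HeightOneSpectrum.valuedAdicCompletion_eq_valuation' v (x : K)

/-- The ring of integers of the number field is dense in that of its completion. -/
theorem exists_valued_sub_algebraMap_le {x : v.adicCompletion K} (hx : Valued.v x ≤ 1) (M : ℕ) :
    ∃ t : 𝓞 K, Valued.v (x - algebraMap K (v.adicCompletion K) t) ≤ exp (-(M : ℤ)) := by
  obtain ⟨k, hk⟩ := (v.denseRange_algebraMap K).exists_mem_open isOpen_interior
    ⟨x, mem_interior_iff_mem_nhds.2 (setOf_valued_sub_lt_mem_nhds v x (-(M : ℤ)))⟩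
  replace hk : Valued.v (algebraMap K (v.adicCompletion K) k - x) < exp (-(M : ℤ)) :=
    (interior_subset hk : algebraMap K (v.adicCompletion K) k ∈
      {y | Valued.v (y - x) < exp (-(M : ℤ))})
  have hM : exp (-(M : ℤ)) ≤ (1 : WithZero (Multiplicative ℤ)) := by
    rw [← exp_zero, exp_le_exp]
    omega
  have hk1 : v.valuation K k ≤ 1 := by
    rw [← HeightOneSpectrum.valuedAdicCompletion_eq_valuation' v k]
    have := Valued.v.map_add (algebraMap K (v.adicCompletion K) k - x) x
    rw [sub_add_cancel] at this
    exact this.trans (max_le (hk.le.trans hM) hx)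
  obtain ⟨t, ht⟩ := v.exists_valuation_sub_lt_of_integer hk1
    (Units.mk0 (exp (-(M : ℤ))) exp_ne_zero)
  refine ⟨t, ?_⟩
  have h1 : Valued.v (algebraMap K (v.adicCompletion K) k -
      algebraMap K (v.adicCompletion K) t) < exp (-(M : ℤ)) := by
    rw [Valuation.map_sub_swap, ← map_sub]
    exact (HeightOneSpectrum.valuedAdicCompletion_eq_valuation' v _).trans_lt ht
  rw [Valuation.map_sub_swap] at hk
  have := Valued.v.map_add (x - algebraMap K (v.adicCompletion K) k)
    (algebraMap K (v.adicCompletion K) k - algebraMap K (v.adicCompletion K) t)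
  rw [sub_add_sub_cancel] at this
  exact this.trans (max_le hk.le h1.le)

lemma le_exp_neg_one_of_lt_one {x : WithZero (Multiplicative ℤ)} (hx : x < 1) : x ≤ exp (-1) := by
  rcases eq_or_ne x 0 with rfl | h0
  · exact zero_le
  · rw [← exp_zero, ← log_lt_iff_lt_exp h0] at hx
    rw [← log_le_iff_le_exp h0]
    omega

lemma valued_algebraMap_le_exp_neg_one {t : 𝓞 K} (ht : t ∈ v.asIdeal) :
    Valued.v (algebraMap K (v.adicCompletion K) t) ≤ exp (-1) := by
  refine le_exp_neg_one_of_lt_one ?_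
  rw [show Valued.v (algebraMap K (v.adicCompletion K) t) = v.valuation K (t : K) from
    HeightOneSpectrum.valuedAdicCompletion_eq_valuation' v _]
  exact (v.valuation_lt_one_iff_mem t).2 ht

lemma valuation_pow_sub_pow_le {R Γ₀ : Type*} [CommRing R] [LinearOrderedCommGroupWithZero Γ₀]
    (w : Valuation R Γ₀) {x y : R} (hx : w x ≤ 1) (hy : w y ≤ 1) (n : ℕ) :
    w (x ^ n - y ^ n) ≤ w (x - y) := by
  induction n with
  | zero => simp
  | succ n ih =>
    have : x ^ (n + 1) - y ^ (n + 1) = x * (x ^ n - y ^ n) + (x - y) * y ^ n := by ring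
    rw [this]
    refine (w.map_add _ _).trans (max_le ?_ ?_)
    · rw [map_mul]
      exact (mul_le_of_le_one_left' hx).trans ih
    · rw [map_mul, map_pow]
      exact mul_le_of_le_one_right' (pow_le_one' hy n)

/-- Raising to a power divisible by the residue characteristic improves congruences to `1`. -/
lemma valuation_pow_pow_sub_one_le {R : Type*} [CommRing R]
    (w : Valuation R (WithZero (Multiplicative ℤ))) {x : R} (hx : w (x - 1) ≤ exp (-1)) {q : ℕ}
    (hq : w q ≤ exp (-1)) (k : ℕ) : w (x ^ q ^ k - 1) ≤ exp (-(k + 1 : ℤ)) := by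
  have h1 : exp (-1 : ℤ) ≤ (1 : WithZero (Multiplicative ℤ)) := by
    rw [← exp_zero, exp_le_exp]
    omega
  have hle : ∀ y, w (y - 1) ≤ exp (-1) → w y ≤ 1 := fun y hy => by
    have := w.map_add (y - 1) 1
    rw [sub_add_cancel, map_one] at this
    exact this.trans (max_le (hy.trans h1) le_rfl)
  induction k with
  | zero => simpa using hx
  | succ k ih =>
    set y := x ^ q ^ k with hy
    have hy1 : w (y - 1) ≤ exp (-1) := ih.trans (by rw [exp_le_exp]; omega)
    have hgeom : w (∑ i ∈ Finset.range q, y ^ i) ≤ exp (-1) := by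
      have : ∑ i ∈ Finset.range q, y ^ i = ∑ i ∈ Finset.range q, (y ^ i - 1) + q := by
        rw [Finset.sum_sub_distrib]
        simp
      rw [this]
      refine (w.map_add _ _).trans (max_le (w.map_sum_le fun i _ => ?_) hq)
      have := valuation_pow_sub_pow_le w (hle y hy1) (y := 1) (by rw [map_one]) i
      rw [one_pow] at this
      exact this.trans hy1
    rw [pow_succ, pow_mul, ← hy, ← mul_geom_sum, map_mul]
    refine (mul_le_mul' ih hgeom).trans ?_
    rw [← exp_add, exp_le_exp]
    push_cast
    omega

lemma exists_eq_mul_pow_of_coprime {G : Type*} [CommGroup G] {ℓ n t : ℕ} (ht : t.Coprime ℓ)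
    [Fact ℓ.Prime] {u η z : G} (hη : η ∈ CommGroup.primaryComponent G ℓ)
    (h : u ^ t = η * z ^ ℓ ^ n) :
    ∃ ξ ∈ CommGroup.primaryComponent G ℓ, ∃ b : G, u = ξ * b ^ ℓ ^ n := by
  obtain ⟨a, b, hab⟩ := Nat.isCoprime_iff_coprime.2 (ht.pow_right n)
  refine ⟨η ^ a, zpow_mem hη a, z ^ a * u ^ b, ?_⟩
  calc u = u ^ (a * (t : ℤ) + b * ((ℓ ^ n : ℕ) : ℤ)) := by rw [hab, zpow_one]
    _ = (u ^ t) ^ a * (u ^ b) ^ ℓ ^ n := by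
      rw [zpow_add, mul_comm a, zpow_mul, zpow_natCast, zpow_mul u b, zpow_natCast]
    _ = _ := by
      have hz : (z ^ ℓ ^ n) ^ a = (z ^ a) ^ ℓ ^ n := by
        rw [← zpow_natCast, ← zpow_natCast, ← zpow_mul, ← zpow_mul, mul_comm]
      rw [h, mul_zpow, mul_pow, mul_assoc, hz]

variable {ℓ : ℕ} [Fact ℓ.Prime]

/-- Away from `ℓ`, a local unit is the product of a root of unity of `ℓ`-power order and of an
`ℓⁿ`-th power. -/
theorem exists_eq_mul_pow_of_valued_eq_one (hv : (ℓ : 𝓞 K) ∉ v.asIdeal) (n : ℕ)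
    {u : (v.adicCompletion K)ˣ} (hu : Valued.v (u : v.adicCompletion K) = 1) :
    ∃ ξ ∈ mu ℓ (v.adicCompletion K), ∃ b : (v.adicCompletion K)ˣ, u = ξ * b ^ ℓ ^ n := by
  have hp : ℓ.Prime := Fact.out
  have : Finite (𝓞 K ⧸ v.asIdeal) := Ideal.finiteQuotientOfFreeOfNeBot v.asIdeal v.ne_bot
  have := v.isMaximal
  let _ := Ideal.Quotient.field v.asIdeal
  let _ := Fintype.ofFinite (𝓞 K ⧸ v.asIdeal)
  set q := Fintype.card (𝓞 K ⧸ v.asIdeal) with hqdef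
  have hqv : (q : 𝓞 K) ∈ v.asIdeal := by
    rw [← Ideal.Quotient.eq_zero_iff_mem, map_natCast, hqdef]
    exact FiniteField.cast_card_eq_zero _
  have hq1 : 1 < q := Fintype.one_lt_card
  have hqℓ : q.Coprime ℓ := by
    refine ((Nat.Prime.coprime_iff_not_dvd hp).2 fun h => hv ?_).symm
    obtain ⟨p, hchar⟩ := CharP.exists (𝓞 K ⧸ v.asIdeal)
    obtain ⟨k, hpp, hqp⟩ := FiniteField.card (𝓞 K ⧸ v.asIdeal) p
    rw [← hqdef] at hqp
    rw [(Nat.prime_dvd_prime_iff_eq hp hpp).1 (hp.dvd_of_dvd_pow (hqp ▸ h)),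
      ← Ideal.Quotient.eq_zero_iff_mem, map_natCast]
    exact CharP.cast_eq_zero _ p
  obtain ⟨s, r, hr, hsr⟩ := Nat.exists_eq_pow_mul_and_not_dvd
    (show q - 1 ≠ 0 by omega) ℓ hp.ne_one
  obtain ⟨M, hM⟩ := exists_pow_eq_of_valued_sub_one_le v (pow_ne_zero (s + n) hp.ne_zero)
  obtain ⟨t, ht⟩ := exists_valued_sub_algebraMap_le v hu.le 1
  have h1 : exp (-1 : ℤ) < (1 : WithZero (Multiplicative ℤ)) := by
    rw [← exp_zero, exp_lt_exp]
    omega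
  have htv : t ∉ v.asIdeal := by
    intro htv
    have := Valued.v.map_add ((u : v.adicCompletion K) - algebraMap K (v.adicCompletion K) t)
      (algebraMap K (v.adicCompletion K) t)
    rw [sub_add_cancel, hu] at this
    exact absurd (this.trans (max_le ht (valued_algebraMap_le_exp_neg_one v htv))) h1.not_ge
  have htq : t ^ (q - 1) - 1 ∈ v.asIdeal := by
    rw [← Ideal.Quotient.eq_zero_iff_mem, map_sub, map_pow, map_one, sub_eq_zero]
    exact FiniteField.pow_card_sub_one_eq_one _ (by rwa [Ne, Ideal.Quotient.eq_zero_iff_mem])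
  have huq : Valued.v ((u : v.adicCompletion K) ^ (q - 1) - 1) ≤ exp (-1) := by
    have h2 := valued_algebraMap_le_exp_neg_one v htq
    have ht1 : Valued.v (algebraMap K (v.adicCompletion K) t) ≤ 1 :=
      HeightOneSpectrum.coe_mem_adicCompletionIntegers v t
    have h3 := (valuation_pow_sub_pow_le Valued.v hu.le ht1 (q - 1)).trans ht
    have := Valued.v.map_add _ _ |>.trans (max_le h3 h2)
    simpa using this
  have hq' : Valued.v (q : v.adicCompletion K) ≤ exp (-1) := by
    simpa using valued_algebraMap_le_exp_neg_one v hqv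
  obtain ⟨z, hz⟩ := hM _ ((valuation_pow_pow_sub_one_le Valued.v huq hq' M).trans
    (by rw [exp_le_exp]; omega))
  have hz0 : z ≠ 0 := by
    rintro rfl
    rw [zero_pow (pow_ne_zero _ hp.ne_zero), eq_comm] at hz
    exact pow_ne_zero _ (pow_ne_zero _ u.ne_zero) hz
  have hz' : Units.mk0 z hz0 ^ ℓ ^ (s + n) = (u ^ (q - 1)) ^ q ^ M := by
    refine Units.ext ?_
    simpa using hz
  have hpow : (u ^ (r * q ^ M) * (Units.mk0 z hz0 ^ ℓ ^ n)⁻¹) ^ ℓ ^ s = 1 := by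
    rw [mul_pow, inv_pow, ← pow_mul, ← pow_mul, ← pow_add, add_comm n, hz', ← pow_mul, hsr,
      mul_right_comm, mul_comm r, mul_inv_cancel]
  refine exists_eq_mul_pow_of_coprime (t := r * q ^ M) (z := Units.mk0 z hz0)
    (Nat.Coprime.mul_left ((Nat.Prime.coprime_iff_not_dvd hp).2 hr).symm (hqℓ.pow_left M))
    ⟨s, hpow⟩ (by simp)

/-- At a place not dividing `ℓ`, the elements whose valuation is divisible by `ℓⁿ` are the products
of a root of unity of `ℓ`-power order and of an `ℓⁿ`-th power. -/
theorem pow_dvd_ord_iff (hv : (ℓ : 𝓞 K) ∉ v.asIdeal) (n : ℕ) (a : Kˣ) :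
    (ℓ ^ n : ℤ) ∣ ord v a ↔ ∃ ξ ∈ mu ℓ (v.adicCompletion K), ∃ b : (v.adicCompletion K)ˣ,
      Units.map (algebraMap K (v.adicCompletion K) : K →* _) a = ξ * b ^ ℓ ^ n := by
  constructor
  · rintro ⟨c, hc⟩
    obtain ⟨π, hπ⟩ := exists_valued_eq_exp v (-c)
    have hπ' : Valued.v (algebraMap K (v.adicCompletion K) π) = exp (-c) :=
      (HeightOneSpectrum.valuedAdicCompletion_eq_valuation' v π).trans hπ
    have hπ0 : algebraMap K (v.adicCompletion K) π ≠ 0 := by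
      intro h
      rw [h, map_zero] at hπ'
      exact exp_ne_zero hπ'.symm
    obtain ⟨ξ, hξ, b, hb⟩ := exists_eq_mul_pow_of_valued_eq_one v hv n
      (u := Units.map (algebraMap K (v.adicCompletion K) : K →* _) a * (Units.mk0 _ hπ0 ^ ℓ ^ n)⁻¹)
      (by
        have : Valued.v (algebraMap K (v.adicCompletion K) a *
            (algebraMap K (v.adicCompletion K) π ^ ℓ ^ n)⁻¹) = 1 := by
          rw [map_mul, map_inv₀, map_pow, hπ', valued_algebraMap_unit, hc, ← exp_nsmul, ← exp_neg,
            ← exp_add, ← exp_zero]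
          congr 1
          rw [nsmul_eq_mul]
          push_cast
          ring
        simpa using this)
    refine ⟨ξ, hξ, b * Units.mk0 _ hπ0, ?_⟩
    rw [mul_pow, ← mul_assoc, ← hb, inv_mul_cancel_right]
  · rintro ⟨ξ, ⟨k, hk⟩, b, hab⟩
    have hξ : Valued.v (ξ : v.adicCompletion K) = 1 := by
      have : Valued.v (ξ : v.adicCompletion K) ^ ℓ ^ k = 1 := by
        rw [← map_pow, ← Units.val_pow_eq_pow_val, hk, Units.val_one, map_one]
      exact (pow_eq_one_iff_of_nonneg zero_le (pow_ne_zero _ (Fact.out : ℓ.Prime).ne_zero)).1 this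
    have h := congrArg (fun x : (v.adicCompletion K)ˣ => Valued.v (x : v.adicCompletion K)) hab
    have hb : Valued.v (b : v.adicCompletion K) ≠ 0 := by simp
    simp only [Units.coe_map, MonoidHom.coe_coe, Units.val_mul, Units.val_pow_eq_pow_val, map_mul,
      map_pow, hξ, one_mul, valued_algebraMap_unit] at h
    rw [← exp_log hb, ← exp_nsmul, exp_inj, nsmul_eq_mul] at h
    exact ⟨-log (Valued.v (b : v.adicCompletion K)), by push_cast at h; linarith⟩

end Local

/-! ### Approximation at the places dividing `ℓ` -/

section Approximation

open WithZero

variable {K : Type*} [Field K] [NumberField K] {ℓ : ℕ} [Fact ℓ.Prime]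

lemma exists_eq_mul_pow_and_valued_le (v : HeightOneSpectrum (𝓞 K)) (b : (v.adicCompletion K)ˣ) :
    ∃ b' z : (v.adicCompletion K)ˣ, b = b' * z ^ ℓ ∧ exp (-(ℓ : ℤ)) ≤ Valued.v b'.val ∧
      Valued.v b'.val ≤ 1 := by
  have hp : 0 < (ℓ : ℤ) := by exact_mod_cast (Fact.out : ℓ.Prime).pos
  have hb : Valued.v (b : v.adicCompletion K) ≠ 0 := by simp
  set m := log (Valued.v (b : v.adicCompletion K)) with hm
  obtain ⟨π, hπ⟩ := exists_valued_eq_exp v (-(-m / ℓ))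
  have hπ' : Valued.v (algebraMap K (v.adicCompletion K) π) = exp (-(-m / ℓ)) :=
    (HeightOneSpectrum.valuedAdicCompletion_eq_valuation' v π).trans hπ
  have hπ0 : algebraMap K (v.adicCompletion K) π ≠ 0 := by
    intro h
    rw [h, map_zero] at hπ'
    exact exp_ne_zero hπ'.symm
  have hv : Valued.v ((b * (Units.mk0 _ hπ0 ^ ℓ)⁻¹ : (v.adicCompletion K)ˣ) : v.adicCompletion K) =
      exp (-(-m % ℓ)) := by
    rw [Units.val_mul, Units.val_inv_eq_inv_val, Units.val_pow_eq_pow_val, Units.val_mk0, map_mul,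
      map_inv₀, map_pow, hπ', ← exp_log hb, ← hm, ← exp_nsmul, ← exp_neg, ← exp_add, nsmul_eq_mul]
    congr 1
    have := Int.emod_add_mul_ediv (-m) ℓ
    linarith
  refine ⟨b * (Units.mk0 _ hπ0 ^ ℓ)⁻¹, Units.mk0 _ hπ0, by simp, ?_, ?_⟩
  · rw [hv, exp_le_exp]
    have := Int.emod_lt_of_pos (-m) hp
    omega
  · rw [hv, ← exp_zero, exp_le_exp]
    have := Int.emod_nonneg (-m) hp.ne'
    omega

/-- The classes of `K_v^×` modulo `ℓ`-th powers are represented by integers of `K`, which matter only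
modulo a fixed power of the prime `v`. -/
theorem exists_forall_sub_mem_pow (v : HeightOneSpectrum (𝓞 K)) :
    ∃ M : ℕ, ∀ b : (v.adicCompletion K)ˣ, ∃ t : 𝓞 K, ∀ r : 𝓞 K, r - t ∈ v.asIdeal ^ M →
      r ≠ 0 ∧ ∃ z : (v.adicCompletion K)ˣ, (b : v.adicCompletion K) =
        algebraMap K (v.adicCompletion K) r * (z : v.adicCompletion K) ^ ℓ := by
  have hp : ℓ.Prime := Fact.out
  obtain ⟨M₀, hM₀⟩ := exists_pow_eq_of_valued_sub_one_le v hp.ne_zero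
  refine ⟨M₀ + ℓ + 1, fun b => ?_⟩
  obtain ⟨b', z', rfl, hb1, hb2⟩ := exists_eq_mul_pow_and_valued_le (ℓ := ℓ) v b
  obtain ⟨t, ht⟩ := exists_valued_sub_algebraMap_le v hb2 (M₀ + ℓ + 1)
  refine ⟨t, fun r hr => ?_⟩
  have hr' : Valued.v (algebraMap K (v.adicCompletion K) t - algebraMap K (v.adicCompletion K) r) ≤
      exp (-((M₀ + ℓ + 1 : ℕ) : ℤ)) := by
    rw [Valuation.map_sub_swap, ← map_sub, ← map_sub]
    rw [show Valued.v (algebraMap K (v.adicCompletion K) (algebraMap (𝓞 K) K (r - t))) =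
      v.valuation K (algebraMap (𝓞 K) K (r - t)) from
      HeightOneSpectrum.valuedAdicCompletion_eq_valuation' v _,
      HeightOneSpectrum.valuation_of_algebraMap]
    exact (v.intValuation_le_pow_iff_mem _ _).2 hr
  have hbr := (Valued.v.map_add _ _).trans (max_le ht hr')
  rw [sub_add_sub_cancel] at hbr
  have hr0 : r ≠ 0 := by
    rintro rfl
    rw [show ((0 : 𝓞 K) : K) = 0 from map_zero _, map_zero, sub_zero] at hbr
    have := hb1.trans hbr
    rw [exp_le_exp] at this
    push_cast at this
    omega
  have hr0' : algebraMap K (v.adicCompletion K) r ≠ 0 := by simpa using hr0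
  have hrv : exp (-(ℓ : ℤ)) ≤ Valued.v (algebraMap K (v.adicCompletion K) r) := by
    by_contra! hlt
    have := Valued.v.map_add ((b' : v.adicCompletion K) - algebraMap K (v.adicCompletion K) r)
      (algebraMap K (v.adicCompletion K) r)
    rw [sub_add_cancel] at this
    refine absurd (hb1.trans this) (not_le.2 (max_lt (hbr.trans_lt ?_) hlt))
    rw [exp_lt_exp]
    push_cast
    omega
  obtain ⟨z, hz⟩ := hM₀ ((b' : v.adicCompletion K) / algebraMap K (v.adicCompletion K) r) (by
    rw [div_sub_one hr0', map_div₀]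
    refine (div_le_div₀ zero_le hbr (by simp) hrv).trans ?_
    rw [← exp_sub, exp_le_exp]
    push_cast
    omega)
  have hz0 : z ≠ 0 := by
    rintro rfl
    rw [zero_pow hp.ne_zero, eq_comm, div_eq_zero_iff] at hz
    exact hz.elim b'.ne_zero hr0'
  refine ⟨hr0, Units.mk0 z hz0 * z', ?_⟩
  rw [Units.val_mul, Units.val_mul, Units.val_pow_eq_pow_val, Units.val_mk0, mul_pow, hz,
    ← mul_assoc, mul_div_cancel₀ _ hr0']

lemma continuous_toZModPow (n : ℕ) : Continuous (PadicInt.toZModPow (p := ℓ) n) := by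
  refine continuous_of_continuousAt_zero (PadicInt.toZModPow (p := ℓ) n) ?_
  rw [ContinuousAt, map_zero, nhds_discrete (ZMod (ℓ ^ n)), Filter.tendsto_pure]
  have hpos : (0 : ℝ) < (ℓ : ℝ) ^ (-n : ℤ) :=
    zpow_pos (Nat.cast_pos.2 (Fact.out : ℓ.Prime).pos) _
  filter_upwards [Metric.ball_mem_nhds (0 : ℤ_[ℓ]) hpos] with x hx
  rw [← RingHom.mem_ker, PadicInt.ker_toZModPow, ← PadicInt.norm_le_pow_iff_mem_span_pow]
  exact (mem_ball_zero_iff.1 hx).le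

lemma finite_setOf_dvd (K : Type*) [Field K] [NumberField K] (ℓ : ℕ) [Fact ℓ.Prime] :
    {v : HeightOneSpectrum (𝓞 K) | (ℓ : 𝓞 K) ∈ v.asIdeal}.Finite := by
  have h : Ideal.span {(ℓ : 𝓞 K)} ≠ 0 := by
    simpa using (Fact.out : ℓ.Prime).ne_zero
  refine (Ideal.finite_factors h).subset fun v hv => ?_
  rw [Set.mem_ofPred_eq, Ideal.dvd_span_singleton]
  exact hv

/-- Finitely many elements of `K^×` represent all classes modulo `ℓ`-th powers of the product of the
`K_v^×` for `v` dividing `ℓ`. -/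
theorem exists_finite_forall_eq_mul_pow (K : Type*) [Field K] [NumberField K] (ℓ : ℕ)
    [Fact ℓ.Prime] :
    ∃ (ι : Type) (_ : Fintype ι) (t : ι → Kˣ), ∀ b : ∀ v : HeightOneSpectrum (𝓞 K),
      (v.adicCompletion K)ˣ, ∃ (i : ι) (z : ∀ v : HeightOneSpectrum (𝓞 K), (v.adicCompletion K)ˣ),
        ∀ v : HeightOneSpectrum (𝓞 K), (ℓ : 𝓞 K) ∈ v.asIdeal →
          b v = Units.map (algebraMap K (v.adicCompletion K) : K →* _) (t i) * z v ^ ℓ := by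
  classical
  choose M hM using exists_forall_sub_mem_pow (K := K) (ℓ := ℓ)
  let S := (finite_setOf_dvd K ℓ).toFinset
  let I : Ideal (𝓞 K) := ∏ v ∈ S, v.asIdeal ^ M v
  have hI : I ≠ ⊥ := Finset.prod_ne_zero_iff.2 fun v _ => pow_ne_zero _ v.ne_bot
  have : Finite (𝓞 K ⧸ I) := Ideal.finiteQuotientOfFreeOfNeBot I hI
  obtain ⟨n, ⟨e⟩⟩ := Finite.exists_equiv_fin (𝓞 K ⧸ I)
  let rep : Fin n → 𝓞 K := fun i => Quotient.out (e.symm i)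
  let t : Fin n → Kˣ := fun i =>
    if h : (rep i : K) = 0 then 1 else Units.mk0 (rep i : K) h
  refine ⟨Fin n, inferInstance, t, fun b => ?_⟩
  choose r hr using fun v => hM v (b v)
  obtain ⟨x, hx⟩ := IsDedekindDomain.exists_forall_sub_mem_ideal (s := S)
    (fun v : HeightOneSpectrum (𝓞 K) => v.asIdeal) M (fun v _ => v.prime)
    (fun v _ w _ hvw h => hvw (HeightOneSpectrum.ext h)) (fun v => r v)
  let i := e (Ideal.Quotient.mk I x)
  have hrep : ∀ v, (ℓ : 𝓞 K) ∈ v.asIdeal → rep i - r v ∈ v.asIdeal ^ M v := by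
    intro v hv
    have hvS : v ∈ S := (Set.Finite.mem_toFinset _).2 hv
    have h1 : rep i - x ∈ I := by
      rw [← Ideal.Quotient.eq]
      simp only [rep, i, Equiv.symm_apply_apply]
      exact Quotient.out_eq _
    have h2 : I ≤ v.asIdeal ^ M v := Ideal.le_of_dvd (Finset.dvd_prod_of_mem _ hvS)
    rw [← sub_add_sub_cancel (rep i) x (r v)]
    exact add_mem (h2 h1) (hx v hvS)
  have key : ∀ v : HeightOneSpectrum (𝓞 K), ∃ z : (v.adicCompletion K)ˣ, (ℓ : 𝓞 K) ∈ v.asIdeal →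
      b v = Units.map (algebraMap K (v.adicCompletion K) : K →* _) (t i) * z ^ ℓ := by
    intro v
    by_cases hv : (ℓ : 𝓞 K) ∈ v.asIdeal
    · obtain ⟨h0, z, hz⟩ := hr v (rep i) (hrep v hv)
      refine ⟨z, fun _ => Units.ext ?_⟩
      have h0' : (rep i : K) ≠ 0 := by simpa using h0
      simp only [t, dif_neg h0']
      exact hz
    · exact ⟨1, fun h => absurd h hv⟩
  choose z hz using key
  exact ⟨i, z, hz⟩

/-- The canonical map from `ℤ_ℓ ⊗ K^×` to the product of the `lim K_v^×/K_v^{×ℓⁿ}`, for `v` dividing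
`ℓ`, is surjective: its image is the continuous image of a free module of finite rank, hence
compact, and it is dense. -/
theorem exists_forall_toLocal_eq
    (y : ∀ v : HeightOneSpectrum (𝓞 K), ProL ℓ (v.adicCompletion K)) :
    ∃ x : Adified ℓ K, ∀ v : HeightOneSpectrum (𝓞 K), (ℓ : 𝓞 K) ∈ v.asIdeal →
      toLocal ℓ (algebraMap K (v.adicCompletion K)) x = y v := by
  classical
  obtain ⟨ι, _, t, ht⟩ := exists_finite_forall_eq_mul_pow K ℓ
  have hpow : ∀ (n : ℕ) (b : ∀ v : HeightOneSpectrum (𝓞 K), (v.adicCompletion K)ˣ),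
      ∃ (c : ι → ℕ) (z : ∀ v : HeightOneSpectrum (𝓞 K), (v.adicCompletion K)ˣ),
        ∀ v : HeightOneSpectrum (𝓞 K), (ℓ : 𝓞 K) ∈ v.asIdeal → b v =
          Units.map (algebraMap K (v.adicCompletion K) : K →* _) (∏ i, t i ^ c i) *
            z v ^ ℓ ^ n := by
    intro n b
    induction n with
    | zero => exact ⟨0, b, fun v _ => by simp⟩
    | succ n ih =>
      obtain ⟨c, z, hz⟩ := ih
      obtain ⟨i, z', hz'⟩ := ht z
      refine ⟨c + Pi.single i (ℓ ^ n), z', fun v hv => ?_⟩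
      have h1 : ∏ j, t j ^ (c + Pi.single i (ℓ ^ n) : ι → ℕ) j = (∏ j, t j ^ c j) * t i ^ ℓ ^ n := by
        simp only [Pi.add_apply, pow_add, Finset.prod_mul_distrib]
        congr 1
        rw [Finset.prod_eq_single i] <;> simp +contextual
      rw [hz v hv, hz' v hv, h1, map_mul, map_pow, mul_pow, ← pow_mul, pow_succ', mul_assoc,
        mul_comm ℓ]
  let X : (ι → ℤ_[ℓ]) → Adified ℓ K := fun c => ∑ i, c i ⊗ₜ Additive.ofMul (t i)
  have hX : ∀ (c : ι → ℤ_[ℓ]) (v : HeightOneSpectrum (𝓞 K)),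
      toLocal ℓ (algebraMap K (v.adicCompletion K)) (X c) = ∑ i, c i • toProL ℓ _
        (Additive.ofMul (Units.map (algebraMap K (v.adicCompletion K) : K →* _) (t i))) := by
    intro c v
    rw [map_sum]
    exact Finset.sum_congr rfl fun i _ => LinearMap.liftBaseChange_tmul _ _ _ _
  let C : ℕ → Set (ι → ℤ_[ℓ]) := fun n => {c | ∀ v : HeightOneSpectrum (𝓞 K),
    (ℓ : 𝓞 K) ∈ v.asIdeal → ProL.red ℓ n (toLocal ℓ (algebraMap K (v.adicCompletion K)) (X c)) =
      ProL.red ℓ n (y v)}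
  have hmono : ∀ n, C (n + 1) ⊆ C n := fun n c hc v hv => ProL.red_eq_of_le n.le_succ (hc v hv)
  have hne : ∀ n, (C n).Nonempty := by
    intro n
    choose a ha using fun v => ProL.exists_red_eq n (y v)
    obtain ⟨c, z, hz⟩ := hpow n fun v => (a v).toMul
    refine ⟨fun i => c i, fun v hv => ?_⟩
    rw [ha, hX]
    have h2 : ∑ i, (c i : ℤ_[ℓ]) • toProL ℓ _
        (Additive.ofMul (Units.map (algebraMap K (v.adicCompletion K) : K →* _) (t i))) =
        toProL ℓ _ (Additive.ofMul
          (Units.map (algebraMap K (v.adicCompletion K) : K →* v.adicCompletion K)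
            (∏ i, t i ^ c i))) := by
      simp only [Nat.cast_smul_eq_nsmul, ← map_nsmul, ← map_sum, ← ofMul_pow, ← ofMul_prod,
        ← map_pow, ← map_prod]
    rw [h2, eq_comm, ProL.red_toProL_eq_iff]
    exact ⟨z v, hz v hv⟩
  have hclosed : ∀ n, IsClosed (C n) := by
    intro n
    have : C n = (fun c : ι → ℤ_[ℓ] => fun i => PadicInt.toZModPow n (c i)) ⁻¹'
        ((fun c : ι → ℤ_[ℓ] => fun i => PadicInt.toZModPow n (c i)) '' C n) := by
      refine Set.Subset.antisymm (Set.subset_preimage_image _ _) ?_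
      rintro c ⟨d, hd, hcd⟩ v hv
      rw [← hd v hv, hX, hX, map_sum, map_sum]
      exact Finset.sum_congr rfl fun i _ => ProL.red_smul_congr n (congrFun hcd i).symm _
    rw [this]
    refine IsClosed.preimage (continuous_pi fun i => ?_) (isClosed_discrete _)
    exact (continuous_toZModPow n).comp (continuous_apply i)
  obtain ⟨c, hc⟩ := IsCompact.nonempty_iInter_of_sequence_nonempty_isCompact_isClosed C hmono hne
    (hclosed 0).isCompact hclosed
  exact ⟨X c, fun v hv => ProL.ext fun n => Set.mem_iInter.1 hc n v hv⟩

end Approximation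

/-! ### Completions in towers -/

section Towers

variable (K : Type*) {L : Type*} [Field K] [NumberField K] [Field L] [NumberField L] [Algebra K L]

lemma continuous_localMap (w : HeightOneSpectrum (𝓞 L)) : Continuous (localMap K w) := by
  have : w.asIdeal.LiesOver (w.under (𝓞 K)).asIdeal := ⟨rfl⟩
  exact (HeightOneSpectrum.adicCompletion.continuous_ofCompletion L w).comp
    (UniformSpace.Completion.continuous_map.comp
      (HeightOneSpectrum.adicCompletion.continuous_toCompletion K (w.under (𝓞 K))))

/-- The completion `L_w` is finite over `K_v`. -/
lemma finite_localMap (w : HeightOneSpectrum (𝓞 L)) : (localMap K w).Finite := by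
  let _ := (localMap K w).toAlgebra
  have : ContinuousSMul ((w.under (𝓞 K)).adicCompletion K) (w.adicCompletion L) :=
    ⟨((continuous_localMap K w).comp continuous_fst).mul continuous_snd⟩
  have : IsScalarTower K ((w.under (𝓞 K)).adicCompletion K) (w.adicCompletion L) :=
    .of_algebraMap_eq fun x => by
      rw [RingHom.algebraMap_toAlgebra, localMap_algebraMap, IsScalarTower.algebraMap_apply K L]
  exact inferInstanceAs (Module.Finite ((w.under (𝓞 K)).adicCompletion K) (w.adicCompletion L))

open scoped Valued in
/-- The completion `L_w` is generated by `K_v` and `L`: the subspace spanned by `L` is dense, and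
closed because it is finite-dimensional over the complete field `K_v`. -/
theorem forall_mem_of_localMap_mem (w : HeightOneSpectrum (𝓞 L)) (T : Subring (w.adicCompletion L))
    (hK : ∀ x, localMap K w x ∈ T) (hL : ∀ x : L, algebraMap L (w.adicCompletion L) x ∈ T)
    (y : w.adicCompletion L) : y ∈ T := by
  let _ := (localMap K w).toAlgebra
  have : ContinuousSMul ((w.under (𝓞 K)).adicCompletion K) (w.adicCompletion L) :=
    ⟨((continuous_localMap K w).comp continuous_fst).mul continuous_snd⟩
  have : Module.Finite ((w.under (𝓞 K)).adicCompletion K) (w.adicCompletion L) :=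
    finite_localMap K w
  let S := Submodule.span ((w.under (𝓞 K)).adicCompletion K)
    (Set.range (algebraMap L (w.adicCompletion L)))
  have hS : IsClosed (S : Set (w.adicCompletion L)) := S.closed_of_finiteDimensional
  have hyS : y ∈ S := by
    have h := (w.denseRange_algebraMap L).closure_range ▸ Set.mem_univ y
    exact (closure_minimal Submodule.subset_span hS) h
  refine Submodule.span_induction ?_ T.zero_mem (fun _ _ _ _ => T.add_mem)
    (fun a x _ hx => T.mul_mem (hK a) hx) hyS
  rintro _ ⟨x, rfl⟩
  exact hL x

/-- The embedding `K_v → L_w` of `localMap`, for a place `v` which is only known to be equal to the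
place below `w`. -/
def localMapOfEq {v : HeightOneSpectrum (𝓞 K)} (w : HeightOneSpectrum (𝓞 L))
    (h : w.under (𝓞 K) = v) : v.adicCompletion K →+* w.adicCompletion L :=
  h ▸ localMap K w

variable {K}

lemma continuous_localMapOfEq {v : HeightOneSpectrum (𝓞 K)} (w : HeightOneSpectrum (𝓞 L))
    (h : w.under (𝓞 K) = v) : Continuous (localMapOfEq K w h) := by
  subst h
  exact continuous_localMap K w

lemma localMapOfEq_algebraMap {v : HeightOneSpectrum (𝓞 K)} (w : HeightOneSpectrum (𝓞 L))
    (h : w.under (𝓞 K) = v) (x : K) :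
    localMapOfEq K w h (algebraMap K (v.adicCompletion K) x) =
      algebraMap L (w.adicCompletion L) (algebraMap K L x) := by
  subst h
  exact localMap_algebraMap K w x

/-- The embeddings of completions are compatible in towers. -/
lemma localMap_comp_localMapOfEq {M : Type*} [Field M] [NumberField M] [Algebra K M] [Algebra M L]
    [IsScalarTower K M L] (w : HeightOneSpectrum (𝓞 L))
    (h : (w.under (𝓞 M)).under (𝓞 K) = w.under (𝓞 K)) :
    (localMap M w).comp (localMapOfEq K (w.under (𝓞 M)) h) = localMap K w := by
  refine RingHom.coe_inj ((HeightOneSpectrum.denseRange_algebraMap K (w.under (𝓞 K))).equalizer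
    ((continuous_localMap M w).comp (continuous_localMapOfEq _ h)) (continuous_localMap K w) ?_)
  funext x
  simp only [Function.comp_apply, RingHom.coe_comp]
  rw [localMapOfEq_algebraMap, localMap_algebraMap, localMap_algebraMap,
    ← IsScalarTower.algebraMap_apply K M L]

omit [NumberField K] [NumberField L] in
lemma under_under {M : Type*} [Field M] [NumberField M] [Algebra K M] [Algebra M L]
    [IsScalarTower K M L] (w : HeightOneSpectrum (𝓞 L)) :
    (w.under (𝓞 M)).under (𝓞 K) = w.under (𝓞 K) := by
  refine HeightOneSpectrum.ext ?_
  exact Ideal.under_under w.asIdeal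

lemma exists_under_eq (L : Type*) [Field L] [NumberField L] [Algebra K L]
    (v : HeightOneSpectrum (𝓞 K)) : ∃ w : HeightOneSpectrum (𝓞 L), w.under (𝓞 K) = v := by
  have := v.isMaximal
  obtain ⟨P, hP, hPv⟩ := Ideal.exists_maximal_ideal_liesOver_of_isIntegral (S := 𝓞 L) v.asIdeal
  refine ⟨⟨P, hP.isPrime, Ideal.ne_bot_of_liesOver_of_ne_bot v.ne_bot P⟩, ?_⟩
  exact HeightOneSpectrum.ext hPv.over.symm

end Towers

/-! ### The largest locally cyclotomic subextension -/

section LocallyCyclotomic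

open IntermediateField

lemma exists_algHom_extends {K L Ω : Type*} [Field K] [Field L] [Field Ω] [Algebra K L]
    [Algebra K Ω] [IsAlgClosed Ω] [Algebra.IsAlgebraic K L] (M : IntermediateField K L)
    (φ : M →ₐ[K] Ω) : ∃ ψ : L →ₐ[K] Ω, ∀ x : M, ψ x = φ x := by
  let _ := φ.toRingHom.toAlgebra
  have : IsScalarTower K M Ω := .of_algebraMap_eq fun y => (φ.commutes y).symm
  have : Algebra.IsAlgebraic M L := Algebra.IsAlgebraic.tower_top (K := K) M
  let ψ : L →ₐ[M] Ω := IsAlgClosed.lift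
  exact ⟨ψ.restrictScalars K, fun x => ψ.commutes x⟩

variable {ℓ : ℕ} {K L : Type*} [Field K] [NumberField K] [Field L] [NumberField L] [Algebra K L]

/-- Whether the image of `x` lies in the cyclotomic `ℤ_ℓ`-extension of `K_v` does not depend on the
choice of an embedding of `L_w` in an algebraic closure of `K_v`. -/
lemma mem_cyclotomic_of_embeddings {v : HeightOneSpectrum (𝓞 K)} (w : HeightOneSpectrum (𝓞 L))
    (h : w.under (𝓞 K) = v) {φ φ' : w.adicCompletion L →+* AlgebraicClosure (v.adicCompletion K)}
    (hφ : φ.comp (localMapOfEq K w h) = algebraMap _ _)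
    (hφ' : φ'.comp (localMapOfEq K w h) = algebraMap _ _) {x : L}
    (hx : φ (algebraMap L _ x) ∈ cyclotomic ℓ (v.adicCompletion K)
      (AlgebraicClosure (v.adicCompletion K))) :
    φ' (algebraMap L _ x) ∈ cyclotomic ℓ (v.adicCompletion K)
      (AlgebraicClosure (v.adicCompletion K)) := by
  let _ := (localMapOfEq K w h).toAlgebra
  let f : w.adicCompletion L →ₐ[v.adicCompletion K] AlgebraicClosure (v.adicCompletion K) :=
    { φ with commutes' := RingHom.congr_fun hφ }
  let f' : w.adicCompletion L →ₐ[v.adicCompletion K] AlgebraicClosure (v.adicCompletion K) :=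
    { φ' with commutes' := RingHom.congr_fun hφ' }
  set y := algebraMap L (w.adicCompletion L) x
  obtain ⟨σ, hσ⟩ := minpoly.exists_algEquiv_of_root' (K := v.adicCompletion K) (x := f' y)
    (y := f y) (Algebra.IsAlgebraic.isAlgebraic _) (by
      rw [minpoly.algHom_eq f f.injective, Polynomial.aeval_algHom_apply, minpoly.aeval, map_zero])
  change f' y ∈ _
  rw [← hσ]
  exact map_mem_cyclotomic σ.toAlgHom hx

lemma exists_embedding (w : HeightOneSpectrum (𝓞 L)) :
    ∃ φ : w.adicCompletion L →+* AlgebraicClosure ((w.under (𝓞 K)).adicCompletion K),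
      φ.comp (localMap K w) = algebraMap _ _ := by
  let _ := (localMap K w).toAlgebra
  have : Module.Finite ((w.under (𝓞 K)).adicCompletion K) (w.adicCompletion L) :=
    finite_localMap K w
  let φ : w.adicCompletion L →ₐ[(w.under (𝓞 K)).adicCompletion K]
    AlgebraicClosure ((w.under (𝓞 K)).adicCompletion K) := IsAlgClosed.lift
  exact ⟨φ, φ.comp_algebraMap⟩

/-- The images of a locally cyclotomic extension `M` of `K` under the embeddings of `M` in `L` and
of `L_w` in an algebraic closure of `K_v` lie in the cyclotomic `ℤ_ℓ`-extension of `K_v`. -/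
theorem IsLocallyCyclotomic.mem_cyclotomic {M : Type*} [Field M] [NumberField M] [Algebra K M]
    (hM : IsLocallyCyclotomic ℓ K M) (τ : M →ₐ[K] L) (w : HeightOneSpectrum (𝓞 L))
    {Φ : w.adicCompletion L →+* AlgebraicClosure ((w.under (𝓞 K)).adicCompletion K)}
    (hΦ : Φ.comp (localMap K w) = algebraMap _ _) (x : M) :
    Φ (algebraMap L _ (τ x)) ∈ cyclotomic ℓ ((w.under (𝓞 K)).adicCompletion K)
      (AlgebraicClosure ((w.under (𝓞 K)).adicCompletion K)) := by
  let _ := τ.toRingHom.toAlgebra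
  have : IsScalarTower K M L := .of_algebraMap_eq fun y => (τ.commutes y).symm
  have hu : (w.under (𝓞 M)).under (𝓞 K) = w.under (𝓞 K) := under_under w
  have hM' : ∀ {v : HeightOneSpectrum (𝓞 K)} (h : (w.under (𝓞 M)).under (𝓞 K) = v),
      ∃ φ : (w.under (𝓞 M)).adicCompletion M →+* AlgebraicClosure (v.adicCompletion K),
        φ.comp (localMapOfEq K (w.under (𝓞 M)) h) = algebraMap _ _ ∧
        ∀ x, φ x ∈ cyclotomic ℓ (v.adicCompletion K) (AlgebraicClosure (v.adicCompletion K)) := by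
    rintro _ rfl
    exact hM (w.under (𝓞 M))
  obtain ⟨φ, hφ, hmem⟩ := hM' hu
  have := mem_cyclotomic_of_embeddings (w.under (𝓞 M)) hu hφ (φ' := Φ.comp (localMap M w))
    (by rw [RingHom.comp_assoc, localMap_comp_localMapOfEq, hΦ]) (hmem (algebraMap M _ x))
  rwa [RingHom.comp_apply, localMap_algebraMap] at this

variable (ℓ K L)

/-- The elements of `L` whose images under all `K`-embeddings of `L` in an algebraic closure of
`K_v` lie in the cyclotomic `ℤ_ℓ`-extension of `K_v`, for all finite places `v` of `K`. -/
def localCyclotomicPart : IntermediateField K L :=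
  ⨅ (v : HeightOneSpectrum (𝓞 K)) (ψ : L →ₐ[K] AlgebraicClosure (v.adicCompletion K)),
    ((cyclotomic ℓ (v.adicCompletion K)
      (AlgebraicClosure (v.adicCompletion K))).restrictScalars K).comap ψ

variable {ℓ K L}

omit [NumberField L] in
lemma mem_localCyclotomicPart {x : L} : x ∈ localCyclotomicPart ℓ K L ↔
    ∀ (v : HeightOneSpectrum (𝓞 K)) (ψ : L →ₐ[K] AlgebraicClosure (v.adicCompletion K)),
      ψ x ∈ cyclotomic ℓ (v.adicCompletion K) (AlgebraicClosure (v.adicCompletion K)) := by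
  simp only [localCyclotomicPart, ← SetLike.mem_coe, coe_iInf, Set.mem_iInter]
  rfl

variable [IsGalois K L]

/-- If `L/K` is Galois, all `K`-embeddings of `L` in an algebraic closure of `K_v` differ by an
automorphism of `L`, so that it suffices to test the embeddings which factor through some `L_w`. -/
theorem isLocallyCyclotomic_iff_le (M : IntermediateField K L) :
    IsLocallyCyclotomic ℓ K M ↔ M ≤ localCyclotomicPart ℓ K L := by
  constructor
  · intro hM x hx
    refine mem_localCyclotomicPart.2 fun v ψ => ?_
    obtain ⟨w, rfl⟩ := exists_under_eq L v
    obtain ⟨Φ, hΦ⟩ := exists_embedding (K := K) w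
    let _ : Algebra L (AlgebraicClosure ((w.under (𝓞 K)).adicCompletion K)) :=
      (Φ.comp (algebraMap L (w.adicCompletion L))).toAlgebra
    have : IsScalarTower K L (AlgebraicClosure ((w.under (𝓞 K)).adicCompletion K)) :=
      .of_algebraMap_eq fun y => by
        rw [RingHom.algebraMap_toAlgebra, RingHom.comp_apply, ← localMap_algebraMap,
          ← RingHom.comp_apply, hΦ]
        exact IsScalarTower.algebraMap_apply K ((w.under (𝓞 K)).adicCompletion K) _ y
    obtain ⟨σ, rfl⟩ := (Normal.algHomEquivAut K
      (AlgebraicClosure ((w.under (𝓞 K)).adicCompletion K)) L).symm.surjective ψ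
    exact hM.mem_cyclotomic (σ.toAlgHom.comp M.val) w hΦ ⟨x, hx⟩
  · intro hM w
    obtain ⟨φ, hφ⟩ := exists_embedding (K := K) w
    refine ⟨φ, hφ, ?_⟩
    refine forall_mem_of_localMap_mem K w ((cyclotomic ℓ ((w.under (𝓞 K)).adicCompletion K)
      (AlgebraicClosure ((w.under (𝓞 K)).adicCompletion K))).toSubalgebra.toSubring.comap φ)
      (fun x => ?_) (fun x => ?_)
    · change φ.comp (localMap K w) x ∈ cyclotomic ℓ _ _
      rw [hφ]
      exact IntermediateField.algebraMap_mem _ _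
    · let φM : M →ₐ[K] AlgebraicClosure ((w.under (𝓞 K)).adicCompletion K) :=
        { φ.comp (algebraMap M (w.adicCompletion M)) with
          commutes' := fun y => by
            change φ (algebraMap M (w.adicCompletion M) (algebraMap K M y)) = _
            rw [← localMap_algebraMap, ← RingHom.comp_apply, hφ]
            exact (IsScalarTower.algebraMap_apply K ((w.under (𝓞 K)).adicCompletion K) _ y).symm }
      obtain ⟨ψ, hψ⟩ := exists_algHom_extends M φM
      have h1 := mem_localCyclotomicPart.1 (hM x.2) (w.under (𝓞 K)) ψ
      rw [hψ] at h1
      exact h1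

theorem maxLocallyCyclotomic_eq : maxLocallyCyclotomic ℓ K L = localCyclotomicPart ℓ K L :=
  le_antisymm (iSup₂_le fun M hM => (isLocallyCyclotomic_iff_le M).1 hM)
    (le_iSup₂_of_le (localCyclotomicPart ℓ K L) ((isLocallyCyclotomic_iff_le _).2 le_rfl) le_rfl)

theorem isGreatest_maxLocallyCyclotomic :
    IsGreatest {M : IntermediateField K L | IsLocallyCyclotomic ℓ K M}
      (maxLocallyCyclotomic ℓ K L) := by
  rw [maxLocallyCyclotomic_eq]
  exact ⟨(isLocallyCyclotomic_iff_le _).2 le_rfl, fun M hM => (isLocallyCyclotomic_iff_le M).1 hM⟩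

theorem isGalois_maxLocallyCyclotomic : IsGalois K (maxLocallyCyclotomic ℓ K L) := by
  rw [maxLocallyCyclotomic_eq]
  have : Normal K (localCyclotomicPart ℓ K L) := by
    rw [normal_iff_forall_map_le']
    rintro σ _ ⟨x, hx, rfl⟩
    exact mem_localCyclotomicPart.2 fun v ψ =>
      mem_localCyclotomicPart.1 hx v (ψ.comp (σ : L →ₐ[K] L))
  exact ⟨⟩

end LocallyCyclotomic

/-! ### Functoriality of divisors and of pseudo-infinitesimal elements -/

section Global

variable {ℓ : ℕ} [Fact ℓ.Prime]

/-- The map `ℤ_ℓ ⊗ M^× → ℤ_ℓ ⊗ L^×` attached to a field embedding. -/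
def Adified.mapOf {M L : Type*} [Field M] [Field L] (f : M →+* L) :
    Adified ℓ M →ₗ[ℤ_[ℓ]] Adified ℓ L :=
  LinearMap.baseChange ℤ_[ℓ] (Units.map (f : M →* L)).toAdditive.toIntLinearMap

lemma Adified.mapOf_tmul {M L : Type*} [Field M] [Field L] (f : M →+* L) (c : ℤ_[ℓ])
    (x : Additive Mˣ) : Adified.mapOf f (c ⊗ₜ x : Adified ℓ M) =
      c ⊗ₜ Additive.ofMul (Units.map (f : M →* L) x.toMul) := rfl

lemma Adified.mapOf_comp {K M L : Type*} [Field K] [Field M] [Field L] (g : M →+* L) (f : K →+* M)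
    (x : Adified ℓ K) : Adified.mapOf g (Adified.mapOf f x) = Adified.mapOf (g.comp f) x := by
  induction x using TensorProduct.induction_on with
  | zero => simp only [map_zero]
  | add x y hx hy => simp only [map_add, hx, hy]
  | tmul a x => rfl

lemma Adified.exists_eq_one_tmul_add {L : Type*} [Field L] (n : ℕ) (x : Adified ℓ L) :
    ∃ (a : Additive Lˣ) (y : Adified ℓ L), x = 1 ⊗ₜ a + (ℓ : ℤ_[ℓ]) ^ n • y := by
  induction x using TensorProduct.induction_on with
  | zero => exact ⟨0, 0, by simp⟩
  | add x y hx hy =>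
    obtain ⟨a, x', rfl⟩ := hx
    obtain ⟨b, y', rfl⟩ := hy
    refine ⟨a + b, x' + y', ?_⟩
    rw [TensorProduct.tmul_add, smul_add, add_add_add_comm]
  | tmul c x =>
    obtain ⟨b, hb⟩ := exists_eq_appr_add n c
    refine ⟨c.appr n • x, b ⊗ₜ x, ?_⟩
    rw [← TensorProduct.smul_tmul, nsmul_one, TensorProduct.smul_tmul', smul_eq_mul,
      ← TensorProduct.add_tmul, ← hb]

lemma toLocal_tmul {K F : Type*} [Field K] [Field F] (f : K →+* F) (c : ℤ_[ℓ]) (x : Additive Kˣ) :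
    toLocal ℓ f (c ⊗ₜ x) = c • toProL ℓ F (Additive.ofMul (Units.map (f : K →* F) x.toMul)) :=
  LinearMap.liftBaseChange_tmul _ _ _ _

variable {K L : Type*} [Field K] [NumberField K] [Field L] [NumberField L]

/-- An element is pseudo-infinitesimal if its images in the `lim K_v^×/K_v^{×ℓⁿ}` are torsion, for
the places `v` dividing `ℓ`. -/
lemma mem_pseudoInfinitesimal_iff {x : Adified ℓ K} : x ∈ pseudoInfinitesimal ℓ K ↔
    ∀ v : HeightOneSpectrum (𝓞 K), (ℓ : 𝓞 K) ∈ v.asIdeal → ∃ k : ℕ,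
      (ℓ : ℤ_[ℓ]) ^ k • toLocal ℓ (algebraMap K (v.adicCompletion K)) x = 0 := by
  simp only [pseudoInfinitesimal, Submodule.mem_iInf, Submodule.mem_comap, mem_muProL_iff]

lemma divisor_tmul_apply (c : ℤ_[ℓ]) (x : Additive Kˣ) (v : TamePlace ℓ K) :
    divisor ℓ K (c ⊗ₜ x) v = c * (ord v.1 x.toMul : ℤ_[ℓ]) := by
  rw [divisor, LinearMap.liftBaseChange_tmul]
  rfl

lemma mapOf_mem_pseudoInfinitesimal (f : K →+* L) {x : Adified ℓ K}
    (hx : x ∈ pseudoInfinitesimal ℓ K) : Adified.mapOf f x ∈ pseudoInfinitesimal ℓ L := by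
  let _ := f.toAlgebra
  refine mem_pseudoInfinitesimal_iff.2 fun w hw => ?_
  obtain ⟨k, hk⟩ := mem_pseudoInfinitesimal_iff.1 hx (w.under (𝓞 K)) (by
    change algebraMap (𝓞 K) (𝓞 L) ℓ ∈ w.asIdeal
    simpa using hw)
  refine ⟨k, ?_⟩
  have h := toLocal_map ℓ K L w x
  rw [show Adified.map ℓ K L x = Adified.mapOf f x from rfl] at h
  rw [h, ← map_smul, hk, map_zero]

variable [Algebra K L]

/-- An element of `ℤ_ℓ ⊗ K^×` which is pseudo-infinitesimal in `L` is pseudo-infinitesimal in `K`,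
because finite extensions of local fields reflect torsion. -/
theorem mem_pseudoInfinitesimal_of_map {x : Adified ℓ K}
    (hx : Adified.map ℓ K L x ∈ pseudoInfinitesimal ℓ L) : x ∈ pseudoInfinitesimal ℓ K := by
  refine mem_pseudoInfinitesimal_iff.2 fun v hv => ?_
  obtain ⟨w, rfl⟩ := exists_under_eq L v
  have hw : (ℓ : 𝓞 L) ∈ w.asIdeal := by
    have : algebraMap (𝓞 K) (𝓞 L) ℓ ∈ w.asIdeal := hv
    simpa using this
  have h := mem_muProL_iff.2 (mem_pseudoInfinitesimal_iff.1 hx w hw)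
  rw [toLocal_map] at h
  let _ := (localMap K w).toAlgebra
  have : Module.Finite ((w.under (𝓞 K)).adicCompletion K) (w.adicCompletion L) :=
    finite_localMap K w
  exact mem_muProL_iff.1 (mem_muProL_of_map h)

lemma exists_ord_eq (v : HeightOneSpectrum (𝓞 K)) (n : ℤ) : ∃ x : Kˣ, ord v x = n := by
  obtain ⟨π, hπ⟩ := exists_valued_eq_exp v (-n)
  have hπ0 : π ≠ 0 := by
    rintro rfl
    rw [map_zero] at hπ
    exact WithZero.exp_ne_zero hπ.symm
  refine ⟨Units.mk0 π hπ0, ?_⟩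
  have := exp_neg_ord v (Units.mk0 π hπ0)
  rw [Units.val_mk0, hπ, WithZero.exp_inj] at this
  omega

omit [NumberField K] in
lemma ramificationIdx_ne_zero (w : HeightOneSpectrum (𝓞 L)) :
    (w.under (𝓞 K)).asIdeal.ramificationIdx' w.asIdeal ≠ 0 := by
  have : w.asIdeal.LiesOver (w.under (𝓞 K)).asIdeal := ⟨rfl⟩
  exact Ideal.IsDedekindDomain.ramificationIdx'_ne_zero_of_liesOver w.asIdeal (w.under (𝓞 K)).ne_bot

lemma extDivisor_apply (a : Divisors ℓ K) (w : TamePlace ℓ L) :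
    extDivisor ℓ K L a w = ((w.1.under (𝓞 K)).asIdeal.ramificationIdx' w.1.asIdeal : ℤ_[ℓ]) *
      a ⟨w.1.under (𝓞 K), under_tame K w⟩ := rfl

omit [Fact ℓ.Prime] in
lemma exists_tamePlace_under_eq (L : Type*) [Field L] [NumberField L] [Algebra K L]
    (v : TamePlace ℓ K) :
    ∃ w : TamePlace ℓ L, (⟨w.1.under (𝓞 K), under_tame K w⟩ : TamePlace ℓ K) = v := by
  obtain ⟨v, hv⟩ := v
  obtain ⟨w, rfl⟩ := exists_under_eq L v
  exact ⟨⟨w, fun hw => hv (by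
    change algebraMap (𝓞 K) (𝓞 L) ℓ ∈ w.asIdeal
    simpa using hw)⟩, rfl⟩

lemma extDivisor_injective : Function.Injective (extDivisor ℓ K L) := by
  refine (injective_iff_map_eq_zero _).2 fun a ha => ?_
  ext v
  obtain ⟨w, rfl⟩ := exists_tamePlace_under_eq L v
  have := DFunLike.congr_fun ha w
  rw [extDivisor_apply, Finsupp.zero_apply, mul_eq_zero] at this
  exact this.resolve_left (Nat.cast_ne_zero.2 (ramificationIdx_ne_zero w.1))

/-- Multiplicativity of ramification indices, read on an element of valuation one. -/
lemma extDivisor_extDivisor {M : Type*} [Field M] [NumberField M] [Algebra K M] [Algebra M L]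
    [IsScalarTower K M L] (a : Divisors ℓ K) :
    extDivisor ℓ M L (extDivisor ℓ K M a) = extDivisor ℓ K L a := by
  ext w
  have hu : (w.1.under (𝓞 M)).under (𝓞 K) = w.1.under (𝓞 K) := under_under w.1
  obtain ⟨x, hx⟩ := exists_ord_eq (w.1.under (𝓞 K)) 1
  have h1 := ord_map (K := K) w.1 x
  have h2 := ord_map (K := M) w.1 (Units.map (algebraMap K M : K →* M) x)
  have h3 := ord_map (K := K) (w.1.under (𝓞 M)) x
  have h4 : Units.map (algebraMap M L : M →* L) (Units.map (algebraMap K M : K →* M) x) =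
      Units.map (algebraMap K L : K →* L) x :=
    Units.ext (IsScalarTower.algebraMap_apply K M L x).symm
  rw [h4, h1, h3, hu, hx, mul_one, mul_one] at h2
  have h2' := congrArg (Int.cast : ℤ → ℤ_[ℓ]) h2
  push_cast at h2'
  simp only [extDivisor_apply, ← mul_assoc, hu, h2']

lemma divisor_mapOf {M : Type*} [Field M] [NumberField M] [Algebra K M] (τ : M →ₐ[K] L)
    {x : Adified ℓ M} {a : Divisors ℓ K} (hx : divisor ℓ M x = extDivisor ℓ K M a) :
    divisor ℓ L (Adified.mapOf (τ : M →+* L) x) = extDivisor ℓ K L a := by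
  let _ := τ.toRingHom.toAlgebra
  have : IsScalarTower K M L := .of_algebraMap_eq fun y => (τ.commutes y).symm
  rw [← extDivisor_extDivisor (M := M) a, ← hx]
  exact divisor_map ℓ M L x

end Global

/-! ### Leopoldt's conjecture and Galois invariants -/

section Leopoldt

variable {ℓ : ℕ} [Fact ℓ.Prime] {L : Type*} [Field L] [NumberField L]

/-- The family of all normalized valuations of a number field. -/
def ordFinsupp (L : Type*) [Field L] [NumberField L] :
    Additive Lˣ →ₗ[ℤ] HeightOneSpectrum (𝓞 L) →₀ ℤ :=
  AddMonoidHom.toIntLinearMap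
    { toFun := fun x => Finsupp.ofSupportFinite (fun v => ord v x.toMul) (ord_finite x.toMul)
      map_zero' := by ext v; exact ord_one v
      map_add' := fun x y => by ext v; exact ord_mul v _ _ }

/-- The `ℤ_ℓ`-linear extension of the normalized valuation at `v`. -/
def adifiedOrd (v : HeightOneSpectrum (𝓞 L)) : Adified ℓ L →ₗ[ℤ_[ℓ]] ℤ_[ℓ] :=
  LinearMap.liftBaseChange ℤ_[ℓ]
    ((Algebra.linearMap ℤ ℤ_[ℓ]).comp ((Finsupp.lapply v).comp (ordFinsupp L)))

lemma adifiedOrd_tmul (v : HeightOneSpectrum (𝓞 L)) (c : ℤ_[ℓ]) (x : Additive Lˣ) :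
    adifiedOrd v (c ⊗ₜ x) = c * (ord v x.toMul : ℤ_[ℓ]) :=
  LinearMap.liftBaseChange_tmul _ _ _ _

lemma adifiedOrd_eq_divisor (v : TamePlace ℓ L) (x : Adified ℓ L) :
    adifiedOrd v.1 x = divisor ℓ L x v := by
  induction x using TensorProduct.induction_on with
  | zero => simp
  | add x y hx hy => rw [map_add, map_add, Finsupp.add_apply, hx, hy]
  | tmul c b => rw [adifiedOrd_tmul, divisor_tmul_apply]

lemma dvd_ord_of_eq_pow {v : HeightOneSpectrum (𝓞 L)} {a : Lˣ} {n : ℕ} {z : (v.adicCompletion L)ˣ}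
    (h : Units.map (algebraMap L (v.adicCompletion L) : L →* _) a = z ^ n) :
    (n : ℤ) ∣ ord v a := by
  have h1 := congrArg (fun u : (v.adicCompletion L)ˣ =>
    WithZero.log (Valued.v (u : v.adicCompletion L))) h
  simp only [Units.coe_map, MonoidHom.coe_coe, Units.val_pow_eq_pow_val, map_pow,
    valued_algebraMap_unit, WithZero.log_exp, WithZero.log_pow, nsmul_eq_mul] at h1
  exact (dvd_neg.1 ⟨_, h1⟩)

lemma adifiedOrd_eq_zero_of_toLocal_eq_zero {v : HeightOneSpectrum (𝓞 L)} {x : Adified ℓ L}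
    (hx : toLocal ℓ (algebraMap L (v.adicCompletion L)) x = 0) : adifiedOrd v x = 0 := by
  have hmem : ∀ n : ℕ, adifiedOrd v x ∈ Ideal.span {(ℓ : ℤ_[ℓ]) ^ n} := fun n => by
    obtain ⟨a, y, rfl⟩ := Adified.exists_eq_one_tmul_add n x
    rw [map_add, map_smul, toLocal_tmul, one_smul] at hx
    have h := congrArg (ProL.red ℓ n) hx
    rw [map_add, ProL.red_pow_smul, add_zero, map_zero, ProL.red_toProL_eq_zero_iff] at h
    obtain ⟨z, hz⟩ := h
    obtain ⟨c, hc⟩ := dvd_ord_of_eq_pow hz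
    rw [map_add, map_smul, adifiedOrd_tmul, one_mul, hc]
    refine add_mem (Ideal.mem_span_singleton.2 ⟨(c : ℤ_[ℓ]), by push_cast; rfl⟩)
      (Ideal.mem_span_singleton.2 ⟨_, rfl⟩)
  by_contra h0
  have h1 := (PadicInt.mem_span_pow_iff_le_valuation _ h0 _).1
    (hmem ((adifiedOrd v x).valuation + 1))
  omega

/-- Under Leopoldt's conjecture, the pseudo-infinitesimal elements with trivial divisor are the roots
of unity. -/
theorem exists_eq_one_tmul_of_divisor_eq_zero (hLeo : LeopoldtConjecture ℓ L) {x : Adified ℓ L}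
    (hx : x ∈ pseudoInfinitesimal ℓ L) (hdiv : divisor ℓ L x = 0) :
    ∃ ζ ∈ mu ℓ L, x = 1 ⊗ₜ Additive.ofMul ζ := by
  rw [mem_pseudoInfinitesimal_iff] at hx
  choose! k hk using hx
  -- The exponent `N` kills the torsion elements at all the places above `ℓ`.
  obtain ⟨N, hN⟩ := ((finite_setOf_dvd L ℓ).image k).bddAbove
  have hloc : ∀ v : HeightOneSpectrum (𝓞 L), (ℓ : 𝓞 L) ∈ v.asIdeal →
      toLocal ℓ (algebraMap L (v.adicCompletion L)) ((ℓ : ℤ_[ℓ]) ^ N • x) = 0 := fun v hv => by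
    have hle : k v ≤ N := hN ⟨v, hv, rfl⟩
    rw [← Nat.sub_add_cancel hle, pow_add, mul_smul, map_smul, map_smul, hk v hv, smul_zero]
  obtain ⟨y, hy⟩ := exists_baseChange_eq_of_forall_int (x := (ℓ : ℤ_[ℓ]) ^ N • x)
    (Units.map (algebraMap (𝓞 L) L : 𝓞 L →* L)).toAdditive.toIntLinearMap (ordFinsupp L)
    (fun b hb => by
      have hval : ∀ (c : Lˣ), (∀ v, ord v c = 0) → ∃ t : 𝓞 L, algebraMap (𝓞 L) L t = c :=
        fun c hc => HeightOneSpectrum.mem_integers_of_valuation_le_one L (c : L) fun v => by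
          rw [← exp_neg_ord, hc v, neg_zero, WithZero.exp_zero]
      have hb0 : ∀ v, ord v b.toMul = 0 := fun v => DFunLike.congr_fun hb v
      obtain ⟨t, ht⟩ := hval b.toMul hb0
      obtain ⟨s, hs⟩ := hval b.toMul⁻¹ fun v => by
        have := ord_mul v b.toMul b.toMul⁻¹
        rw [mul_inv_cancel, ord_one, hb0 v] at this
        omega
      have hts : t * s = 1 := FaithfulSMul.algebraMap_injective (𝓞 L) L (by
        rw [map_mul, ht, hs, map_one, Units.mul_inv])
      exact ⟨Additive.ofMul ⟨t, s, hts, by rw [mul_comm, hts]⟩,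
        congrArg Additive.ofMul (Units.ext ht)⟩)
    (fun u => by
      ext v
      have h : ∀ u : (𝓞 L)ˣ, ord v (Units.map (algebraMap (𝓞 L) L : 𝓞 L →* L) u) ≥ 0 := fun u => by
        have : v.valuation L (Units.map (algebraMap (𝓞 L) L : 𝓞 L →* L) u : Lˣ) ≤ 1 :=
          v.valuation_le_one (u : 𝓞 L)
        rw [← exp_neg_ord, ← WithZero.exp_zero, WithZero.exp_le_exp] at this
        omega
      have h1 := h u.toMul
      have h2 := h u.toMul⁻¹
      have h3 := ord_mul v (Units.map (algebraMap (𝓞 L) L : 𝓞 L →* L) u.toMul)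
        (Units.map (algebraMap (𝓞 L) L : 𝓞 L →* L) u.toMul⁻¹)
      rw [← map_mul, mul_inv_cancel, map_one, ord_one] at h3
      change ord v (Units.map (algebraMap (𝓞 L) L : 𝓞 L →* L) u.toMul) = 0
      omega)
    (fun v => by
      change adifiedOrd v _ = 0
      by_cases hv : (ℓ : 𝓞 L) ∈ v.asIdeal
      · exact adifiedOrd_eq_zero_of_toLocal_eq_zero (hloc v hv)
      · rw [map_smul, adifiedOrd_eq_divisor ⟨v, hv⟩, hdiv, Finsupp.zero_apply, smul_zero])
  have hy0 : y = 0 := hLeo y fun v hv => by rw [hy]; exact hloc v hv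
  rw [hy0, map_zero] at hy
  obtain ⟨ζ, hζ, rfl⟩ := exists_one_tmul_of_pow_smul_eq_zero hy.symm
  exact ⟨ζ.toMul, ⟨N, hζ⟩, rfl⟩

end Leopoldt

section Invariants

variable {ℓ : ℕ} [Fact ℓ.Prime] {K L : Type*} [Field K] [Field L] [Algebra K L]

lemma Adified.map_injective : Function.Injective (Adified.map ℓ K L) :=
  baseChange_injective fun x y h => by
    have h' : Units.map (algebraMap K L : K →* L) x.toMul =
        Units.map (algebraMap K L : K →* L) y.toMul := h
    exact Units.map_injective (algebraMap K L).injective h'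

lemma Adified.one_tmul_injOn {ζ ξ : Lˣ} (hζ : ζ ∈ mu ℓ L) (hξ : ξ ∈ mu ℓ L)
    (h : (1 ⊗ₜ Additive.ofMul ζ : Adified ℓ L) = 1 ⊗ₜ Additive.ofMul ξ) : ζ = ξ := by
  obtain ⟨k, hk⟩ := div_mem hζ hξ
  rw [← sub_eq_zero, ← TensorProduct.tmul_sub] at h
  have h1 : ℓ ^ k • (Additive.ofMul ζ - Additive.ofMul ξ) = 0 := hk
  exact Additive.ofMul.injective (sub_eq_zero.1 (eq_zero_of_one_tmul_eq_zero h1 h))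

/-- Galois descent for the `ℓ`-adification of the multiplicative group. -/
theorem Adified.exists_map_eq_of_forall [FiniteDimensional K L] [IsGalois K L] {x : Adified ℓ L}
    (hx : ∀ σ : Gal(L/K), Adified.mapOf (σ : L →+* L) x = x) : ∃ y, Adified.map ℓ K L y = x := by
  refine exists_baseChange_eq_of_forall _
    (fun σ : Gal(L/K) =>
      (Units.map ((σ : L →+* L) : L →* L)).toAdditive.toIntLinearMap - LinearMap.id)
    (fun b hb => ?_) (fun σ a => ?_) (fun σ => ?_)
  · have h : (b.toMul : L) ∈ (⊥ : IntermediateField K L) :=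
      (IsGalois.mem_bot_iff_fixed _).2 fun σ =>
        congrArg (fun c : Additive Lˣ => (c.toMul : L)) (sub_eq_zero.1 (hb σ))
    obtain ⟨a, ha⟩ := IntermediateField.mem_bot.1 h
    have ha0 : a ≠ 0 := by
      rintro rfl
      exact b.toMul.ne_zero (by rw [← ha, map_zero])
    exact ⟨Additive.ofMul (Units.mk0 a ha0), congrArg Additive.ofMul (Units.ext ha)⟩
  · exact sub_eq_zero.2 (congrArg Additive.ofMul (Units.ext (σ.commutes _)))
  · rw [LinearMap.baseChange_sub, LinearMap.sub_apply, LinearMap.baseChange_id]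
    exact sub_eq_zero.2 (hx σ)

end Invariants

/-! ### Kummer theory -/

section Kummer

variable {ℓ : ℕ} {K L : Type*} [Field K] [Field L] [Algebra K L]

/-- By Hilbert's theorem 90, the characters of `Gal(L/K)` with values in `μ_K` are Kummer
characters. -/
theorem exists_kummer_generator [FiniteDimensional K L] (χ : Gal(L/K) →* mu ℓ K) :
    ∃ x₀ : Lˣ, ∀ σ : Gal(L/K), Units.map ((σ : L →+* L) : L →* L) x₀ =
      Units.map (algebraMap K L : K →* L) (χ σ : Kˣ) * x₀ := by
  obtain ⟨x₀, h⟩ := groupCohomology.isMulCoboundary₁_of_isMulCocycle₁_of_aut_to_units (K := K)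
    (L := L) (fun σ => Units.map (algebraMap K L : K →* L) (χ σ : Kˣ)) (fun σ τ => by
      beta_reduce
      rw [map_mul, Subgroup.coe_mul, map_mul, mul_comm]
      congr 1
      exact Units.ext (σ.commutes _).symm)
  exact ⟨x₀, fun σ => div_eq_iff_eq_mul.1 (h σ)⟩

/-- The image of a character of a finite group with values in `μ_K` is the group of all `ℓⁿ`-th roots
of unity for some `n`, and `K` contains a primitive one. -/
lemma exists_primitiveRoot_of_monoidHom [Fact ℓ.Prime] {G : Type*} [Group G] [Finite G] (χ : G →* mu ℓ K) :
    ∃ (n : ℕ) (ζ₀ : K), IsPrimitiveRoot ζ₀ (ℓ ^ n) ∧ ∀ σ, χ σ ^ ℓ ^ n = 1 := by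
  let H : Subgroup Kˣ := χ.range.map (mu ℓ K).subtype
  have hmem : ∀ σ, (χ σ : Kˣ) ∈ H := fun σ => ⟨χ σ, ⟨σ, rfl⟩, rfl⟩
  have : Finite H := by
    have : Finite χ.range := Set.finite_range χ
    exact Set.Finite.image _ (Set.toFinite (χ.range : Set (mu ℓ K)))
  have : IsCyclic H := isCyclic_subgroup_units H
  obtain ⟨g, hg⟩ := IsCyclic.exists_ofOrder_eq_natCard (α := H)
  obtain ⟨z, -, hz⟩ := g.2
  obtain ⟨k, hk⟩ := z.2
  have ho : orderOf (z : Kˣ) = Nat.card H := by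
    rw [← hg, ← Subgroup.orderOf_coe g]
    exact congrArg orderOf hz
  obtain ⟨n, -, hn⟩ := (Nat.dvd_prime_pow (Fact.out : ℓ.Prime)).1 (orderOf_dvd_of_pow_eq_one hk)
  refine ⟨n, ((z : Kˣ) : K), ?_, fun σ => ?_⟩
  · rw [← hn, ← orderOf_units]
    exact IsPrimitiveRoot.orderOf _
  · rw [← hn, ho]
    have h1 : (⟨χ σ, hmem σ⟩ : H) ^ Nat.card H = 1 := pow_card_eq_one'
    exact Subtype.ext (congrArg (Subtype.val : H → Kˣ) h1)

lemma exists_eq_pow_of_kummer [FiniteDimensional K L] [IsGalois K L] {χ : Gal(L/K) →* mu ℓ K} {x₀ : Lˣ}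
    (hx₀ : ∀ σ : Gal(L/K), Units.map ((σ : L →+* L) : L →* L) x₀ =
      Units.map (algebraMap K L : K →* L) (χ σ : Kˣ) * x₀) {m : ℕ} (hm : ∀ σ, χ σ ^ m = 1) :
    ∃ a : Kˣ, Units.map (algebraMap K L : K →* L) a = x₀ ^ m := by
  have h : ((x₀ ^ m : Lˣ) : L) ∈ (⊥ : IntermediateField K L) :=
    (IsGalois.mem_bot_iff_fixed _).2 fun σ => by
      have h1 := congrArg (fun u : Lˣ => u ^ m) (hx₀ σ)
      simp only [mul_pow, ← map_pow] at h1
      rw [← Subgroup.coe_pow, hm, Subgroup.coe_one, map_one, one_mul] at h1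
      exact congrArg Units.val h1
  obtain ⟨a, ha⟩ := IntermediateField.mem_bot.1 h
  have ha0 : a ≠ 0 := by
    rintro rfl
    exact (x₀ ^ m).ne_zero (by rw [← ha, map_zero])
  exact ⟨Units.mk0 a ha0, Units.ext ha⟩

/-- A Kummer character factors through `Gal(M/K)` if and only if its radical belongs to `M`. -/
lemma exists_comp_restrictNormalHom_iff [FiniteDimensional K L] [IsGalois K L] (M : IntermediateField K L) [Normal K M]
    {χ : Gal(L/K) →* mu ℓ K} {x₀ : Lˣ}
    (hx₀ : ∀ σ : Gal(L/K), Units.map ((σ : L →+* L) : L →* L) x₀ =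
      Units.map (algebraMap K L : K →* L) (χ σ : Kˣ) * x₀) :
    (∃ χ' : Gal(M/K) →* mu ℓ K, χ'.comp (AlgEquiv.restrictNormalHom M) = χ) ↔ (x₀ : L) ∈ M := by
  constructor
  · rintro ⟨χ', rfl⟩
    rw [← IsGalois.fixedField_fixingSubgroup M]
    rintro ⟨σ, hσ⟩
    rw [← IntermediateField.restrictNormalHom_ker, MonoidHom.mem_ker] at hσ
    have h := hx₀ σ
    rw [MonoidHom.comp_apply, hσ, map_one, Subgroup.coe_one, map_one, one_mul] at h
    exact congrArg Units.val h
  · intro hx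
    refine ⟨MonoidHom.liftOfSurjective _ (AlgEquiv.restrictNormalHom_surjective L) ⟨χ, ?_⟩,
      MonoidHom.liftOfRightInverse_comp _ _ _ _⟩
    intro σ hσ
    rw [IntermediateField.restrictNormalHom_ker] at hσ
    have h : Units.map ((σ : L →+* L) : L →* L) x₀ = x₀ :=
      Units.ext ((IntermediateField.mem_fixingSubgroup_iff M σ).1 hσ _ hx)
    rw [hx₀ σ, mul_eq_right, ← map_one (Units.map (algebraMap K L : K →* L))] at h
    exact Subtype.ext (Units.map_injective (algebraMap K L).injective h)

lemma pow_smul_one_tmul [Fact ℓ.Prime] {n : ℕ} {x₀ : Lˣ} {a : Kˣ}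
    (ha : Units.map (algebraMap K L : K →* L) a = x₀ ^ ℓ ^ n) :
    (ℓ : ℤ_[ℓ]) ^ n • (1 ⊗ₜ Additive.ofMul x₀ : Adified ℓ L) =
      Adified.map ℓ K L (1 ⊗ₜ Additive.ofMul a) := by
  rw [← Nat.cast_pow, Nat.cast_smul_eq_nsmul, ← TensorProduct.tmul_smul, ← ofMul_pow, ← ha]
  rfl

lemma pow_smul_one_tmul_add [Fact ℓ.Prime] {n : ℕ} {x₀ : Lˣ} {a : Kˣ}
    (ha : Units.map (algebraMap K L : K →* L) a = x₀ ^ ℓ ^ n) (y : Adified ℓ K) :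
    (ℓ : ℤ_[ℓ]) ^ n • (1 ⊗ₜ Additive.ofMul x₀ + Adified.map ℓ K L y) =
      Adified.map ℓ K L (1 ⊗ₜ Additive.ofMul a + (ℓ : ℤ_[ℓ]) ^ n • y) := by
  rw [smul_add, pow_smul_one_tmul ha, map_add, map_smul]

end Kummer

/-! ### The radicals of locally cyclotomic extensions -/

section Radicals

variable {ℓ : ℕ} [Fact ℓ.Prime] {K L : Type*} [Field K] [NumberField K] [Field L] [NumberField L]
  [Algebra K L]

lemma smul_mem_pseudoInfinitesimal_iff {n : ℕ} {x : Adified ℓ K} :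
    (ℓ : ℤ_[ℓ]) ^ n • x ∈ pseudoInfinitesimal ℓ K ↔ x ∈ pseudoInfinitesimal ℓ K := by
  refine ⟨fun h => mem_pseudoInfinitesimal_iff.2 fun v hv => ?_, Submodule.smul_mem _ _⟩
  obtain ⟨k, hk⟩ := mem_pseudoInfinitesimal_iff.1 h v hv
  exact ⟨k + n, by rwa [pow_add, mul_smul, ← map_smul]⟩

lemma mem_localCyclotomicPart_iff_of_pow_eq (hℓ : ℓ ≠ 2) {n : ℕ} {ζ₀ : K}
    (hζ₀ : IsPrimitiveRoot ζ₀ (ℓ ^ n)) {x₀ : Lˣ} {a : Kˣ}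
    (ha : Units.map (algebraMap K L : K →* L) a = x₀ ^ ℓ ^ n) :
    (x₀ : L) ∈ localCyclotomicPart ℓ K L ↔ ∀ v : HeightOneSpectrum (𝓞 K),
      ∃ ξ ∈ mu ℓ (v.adicCompletion K), ∃ b : (v.adicCompletion K)ˣ,
        Units.map (algebraMap K (v.adicCompletion K) : K →* _) a = ξ * b ^ ℓ ^ n := by
  have ha' : algebraMap K L a = (x₀ : L) ^ ℓ ^ n := congrArg Units.val ha
  rcases Nat.eq_zero_or_pos n with rfl | hn
  · refine iff_of_true ?_ fun v => ⟨1, one_mem _, _, by rw [one_mul, pow_zero, pow_one]⟩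
    rw [pow_zero, pow_one] at ha'
    rw [← ha']
    exact algebraMap_mem _ _
  · rw [mem_localCyclotomicPart]
    refine forall_congr' fun v => ?_
    have hroot := hζ₀.map_of_injective (algebraMap K (v.adicCompletion K)).injective
    have h : ∀ ψ : L →ₐ[K] AlgebraicClosure (v.adicCompletion K), (ψ x₀) ^ ℓ ^ n = algebraMap
        (v.adicCompletion K) (AlgebraicClosure (v.adicCompletion K))
        (Units.map (algebraMap K (v.adicCompletion K) : K →* _) a : (v.adicCompletion K)ˣ) :=
      fun ψ => by
        rw [← map_pow, ← ha', ψ.commutes]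
        exact IsScalarTower.algebraMap_apply K (v.adicCompletion K) _ _
    refine ⟨fun hx => ?_, fun hx ψ => (mem_cyclotomic_iff hℓ hn hroot (h ψ)).2 hx⟩
    have ψ : L →ₐ[K] AlgebraicClosure (v.adicCompletion K) := IsAlgClosed.lift
    exact (mem_cyclotomic_iff hℓ hn hroot (h ψ)).1 (hx ψ)

lemma dvd_of_intCast_eq {n : ℕ} {m : ℤ} {c : ℤ_[ℓ]} (h : (m : ℤ_[ℓ]) = (ℓ : ℤ_[ℓ]) ^ n * c) :
    (ℓ ^ n : ℤ) ∣ m := by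
  have h1 := congrArg (PadicInt.toZModPow n) h
  rw [map_mul, map_pow, map_natCast, ← Nat.cast_pow, ZMod.natCast_self, zero_mul, map_intCast,
    ZMod.intCast_zmod_eq_zero_iff_dvd] at h1
  exact_mod_cast h1

/-- Let `a = x₀ ^ ℓⁿ` belong to `K`. The element `x₀` becomes pseudo-infinitesimal, with a divisor
coming from `K`, after multiplication by an element of `ℤ_ℓ ⊗ K^×` if and only if `a` is, at every
finite place `v`, the product of a root of unity and of an `ℓⁿ`-th power. The places `v` above `ℓ`
account for the pseudo-infinitesimality, and the other ones for the divisor. -/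
theorem exists_mem_pseudoInfinitesimal_iff {n : ℕ} {x₀ : Lˣ} {a : Kˣ}
    (ha : Units.map (algebraMap K L : K →* L) a = x₀ ^ ℓ ^ n) :
    (∃ y : Adified ℓ K, 1 ⊗ₜ Additive.ofMul x₀ + Adified.map ℓ K L y ∈ pseudoInfinitesimal ℓ L ∧
      ∃ d : Divisors ℓ K, divisor ℓ L (1 ⊗ₜ Additive.ofMul x₀ + Adified.map ℓ K L y) =
        extDivisor ℓ K L d) ↔
    ∀ v : HeightOneSpectrum (𝓞 K),
      ∃ ξ ∈ mu ℓ (v.adicCompletion K), ∃ b : (v.adicCompletion K)ˣ,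
        Units.map (algebraMap K (v.adicCompletion K) : K →* _) a = ξ * b ^ ℓ ^ n := by
  have hℓ0 : (ℓ : ℤ_[ℓ]) ^ n ≠ 0 := pow_ne_zero n (Nat.cast_ne_zero.2 (Fact.out : ℓ.Prime).ne_zero)
  constructor
  · rintro ⟨y, hy, d, hd⟩ v
    by_cases hv : (ℓ : 𝓞 K) ∈ v.asIdeal
    · rw [← smul_mem_pseudoInfinitesimal_iff (n := n), pow_smul_one_tmul_add ha] at hy
      have h1 := mem_pseudoInfinitesimal_of_map hy
      obtain ⟨ξ, hξ, h⟩ := mem_muProL_iff.2 (mem_pseudoInfinitesimal_iff.1 h1 v hv)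
      rw [map_add, map_smul, toLocal_tmul, one_smul] at h
      have h2 := congrArg (ProL.red ℓ n) h
      rw [map_add, ProL.red_pow_smul, add_zero, ← sub_eq_zero, ← map_sub, ← map_sub,
        ProL.red_toProL_eq_zero_iff] at h2
      obtain ⟨b, hb⟩ := h2
      exact ⟨ξ, hξ, b, div_eq_iff_eq_mul'.1 hb⟩
    · rw [← pow_dvd_ord_iff v hv]
      have h1 : divisor ℓ K (1 ⊗ₜ Additive.ofMul a + (ℓ : ℤ_[ℓ]) ^ n • y) =
          (ℓ : ℤ_[ℓ]) ^ n • d := by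
        apply extDivisor_injective (L := L)
        rw [← divisor_map, ← pow_smul_one_tmul_add ha, map_smul, hd, map_smul]
      have h2 := DFunLike.congr_fun h1 ⟨v, hv⟩
      rw [map_add, map_smul, Finsupp.add_apply, divisor_tmul_apply, one_mul, Finsupp.smul_apply,
        Finsupp.smul_apply, smul_eq_mul, smul_eq_mul, ← eq_sub_iff_add_eq, ← mul_sub] at h2
      exact dvd_of_intCast_eq h2
  · intro h
    choose ξ hξ b hb using h
    -- The element `y` cancels the `ℓⁿ`-th power part of `a` at the places above `ℓ`.
    obtain ⟨y, hy⟩ := exists_forall_toLocal_eq (ℓ := ℓ) (K := K)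
      fun v => -toProL ℓ (v.adicCompletion K) (Additive.ofMul (b v))
    refine ⟨y, ?_, ?_⟩
    · rw [← smul_mem_pseudoInfinitesimal_iff (n := n), pow_smul_one_tmul_add ha]
      refine mapOf_mem_pseudoInfinitesimal (algebraMap K L)
        (mem_pseudoInfinitesimal_iff.2 fun v hv => mem_muProL_iff.1 ⟨ξ v, hξ v, ?_⟩)
      rw [map_add, map_smul, toLocal_tmul, one_smul, hy v hv, toMul_ofMul, hb v, ofMul_mul, map_add,
        ofMul_pow, map_nsmul, ← Nat.cast_smul_eq_nsmul ℤ_[ℓ], Nat.cast_pow, smul_neg,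
        add_neg_cancel_right]
    · -- Outside `ℓ`, the valuations of `a` are divisible by `ℓⁿ`.
      let d₀ : Divisors ℓ K := Finsupp.ofSupportFinite
        (fun v => ((ord v.1 a / ℓ ^ n : ℤ) : ℤ_[ℓ])) (by
          refine ((ord_finite a).preimage Subtype.val_injective.injOn).subset fun v hv h0 => hv ?_
          change ((ord v.1 a / ℓ ^ n : ℤ) : ℤ_[ℓ]) = 0
          rw [h0, Int.zero_ediv, Int.cast_zero])
      have hd₀ : (ℓ : ℤ_[ℓ]) ^ n • d₀ = divisor ℓ K (1 ⊗ₜ Additive.ofMul a) := by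
        ext v
        obtain ⟨c, hc⟩ := (pow_dvd_ord_iff v.1 v.2 n a).2 ⟨ξ v.1, hξ v.1, b v.1, hb v.1⟩
        rw [divisor_tmul_apply, one_mul, Finsupp.smul_apply, smul_eq_mul, toMul_ofMul]
        change (ℓ : ℤ_[ℓ]) ^ n * ((ord v.1 a / ℓ ^ n : ℤ) : ℤ_[ℓ]) = _
        rw [hc, Int.mul_ediv_cancel_left _
          (pow_ne_zero n (Nat.cast_ne_zero.2 (Fact.out : ℓ.Prime).ne_zero))]
        push_cast
        rfl
      refine ⟨d₀ + divisor ℓ K y, ?_⟩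
      rw [map_add, map_add, divisor_map]
      congr 1
      apply smul_right_injective _ hℓ0
      change (ℓ : ℤ_[ℓ]) ^ n • _ = (ℓ : ℤ_[ℓ]) ^ n • _
      rw [← map_smul, pow_smul_one_tmul ha, divisor_map, ← hd₀, map_smul]

end Radicals

/-! ### The capitulation kernel -/

section Characters

variable {ℓ : ℕ} {K L : Type*} [Field K] [Field L] [Algebra K L]

lemma map_mem_mu {ζ : Kˣ} (hζ : ζ ∈ mu ℓ K) :
    Units.map (algebraMap K L : K →* L) ζ ∈ mu ℓ L := by
  obtain ⟨k, hk⟩ := hζ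
  exact ⟨k, by rw [← map_pow, hk, map_one]⟩

variable (ℓ) in
/-- Inflation of characters from `Gal(M/K)` to `Gal(L/K)`. -/
def inflation (M : IntermediateField K L) [Normal K L] [Normal K M] :
    Additive (Gal(M/K) →* mu ℓ K) →+ Additive (Gal(L/K) →* mu ℓ K) :=
  (MonoidHom.compHom' (AlgEquiv.restrictNormalHom M)).toAdditive

lemma inflation_injective (M : IntermediateField K L) [Normal K L] [Normal K M] :
    Function.Injective (inflation ℓ M) := fun _ _ h =>
  Additive.toMul.injective ((MonoidHom.cancel_right
    (AlgEquiv.restrictNormalHom_surjective (F := K) (K₁ := M) L)).1 (congrArg Additive.toMul h))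

variable [Fact ℓ.Prime]

variable (ℓ K L) in
/-- A character of `Gal(L/K)` with values in `μ_K`, as a cochain with values in `ℤ_ℓ ⊗ L^×`. -/
def charToCochain : Additive (Gal(L/K) →* mu ℓ K) →+ (Gal(L/K) → Adified ℓ L) where
  toFun χ σ := 1 ⊗ₜ Additive.ofMul (Units.map (algebraMap K L : K →* L) (χ.toMul σ : Kˣ))
  map_zero' := by
    funext σ
    change (1 ⊗ₜ Additive.ofMul (Units.map (algebraMap K L : K →* L) (1 : Kˣ)) : Adified ℓ L) = 0
    rw [map_one, ofMul_one, TensorProduct.tmul_zero]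
  map_add' χ ψ := by
    funext σ
    change (1 ⊗ₜ Additive.ofMul (Units.map (algebraMap K L : K →* L)
      ((χ.toMul σ : Kˣ) * (ψ.toMul σ : Kˣ))) : Adified ℓ L) = _
    rw [map_mul, ofMul_mul, TensorProduct.tmul_add]
    rfl

lemma one_tmul_map_injOn {ζ ξ : Kˣ} (hζ : ζ ∈ mu ℓ K) (hξ : ξ ∈ mu ℓ K)
    (h : (1 ⊗ₜ Additive.ofMul (Units.map (algebraMap K L : K →* L) ζ) : Adified ℓ L) =
      1 ⊗ₜ Additive.ofMul (Units.map (algebraMap K L : K →* L) ξ)) : ζ = ξ :=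
  Units.map_injective (algebraMap K L).injective
    (Adified.one_tmul_injOn (map_mem_mu hζ) (map_mem_mu hξ) h)

lemma charToCochain_injective : Function.Injective (charToCochain ℓ K L) := fun χ ψ h =>
  Additive.toMul.injective (MonoidHom.ext fun σ => Subtype.ext
    (one_tmul_map_injOn (L := L) (χ.toMul σ).2 (ψ.toMul σ).2 (congrFun h σ)))

lemma mapOf_map (σ : Gal(L/K)) (y : Adified ℓ K) :
    Adified.mapOf (σ : L →+* L) (Adified.map ℓ K L y) = Adified.map ℓ K L y := by
  refine (Adified.mapOf_comp _ (algebraMap K L) y).trans ?_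
  rw [show (σ : L →+* L).comp (algebraMap K L) = algebraMap K L from RingHom.ext σ.commutes]
  rfl

end Characters

section Capitulation

variable {ℓ : ℕ} [Fact ℓ.Prime] {K L : Type*} [Field K] [NumberField K] [Field L] [NumberField L]
  [Algebra K L]

variable (ℓ K L) in
/-- The pairs `(𝔞, x)` of a divisor `𝔞` of `K` and a pseudo-infinitesimal generator `x` of its
extension to `L`. -/
def trivializations : AddSubgroup (Divisors ℓ K × Adified ℓ L) where
  carrier := {p | p.2 ∈ pseudoInfinitesimal ℓ L ∧ divisor ℓ L p.2 = extDivisor ℓ K L p.1}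
  zero_mem' := ⟨zero_mem _, by simp⟩
  add_mem' := fun hp hq => ⟨add_mem hp.1 hq.1, by
    rw [Prod.snd_add, Prod.fst_add, map_add, map_add, hp.2, hq.2]⟩
  neg_mem' := fun hp => ⟨neg_mem hp.1, by rw [Prod.snd_neg, Prod.fst_neg, map_neg, map_neg, hp.2]⟩

variable (ℓ K L) in
/-- The class in the capitulation kernel of a divisor which becomes principal in `L`. -/
def trivializationsToCap : trivializations ℓ K L →+ CapBP ℓ K L where
  toFun p := ⟨Submodule.Quotient.mk p.1.1,
    (Submodule.Quotient.mk_eq_zero _).2 ⟨p.1.2, p.2.1, p.2.2⟩⟩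
  map_zero' := rfl
  map_add' _ _ := rfl

lemma trivializationsToCap_surjective : Function.Surjective (trivializationsToCap ℓ K L) := by
  rintro ⟨c, hc⟩
  obtain ⟨a, rfl⟩ := Submodule.Quotient.mk_surjective _ c
  obtain ⟨x, hx, hxa⟩ := (Submodule.Quotient.mk_eq_zero (principalBP ℓ L)).1 hc
  exact ⟨⟨(a, x), hx, hxa⟩, rfl⟩

variable (ℓ K L) in
/-- The coboundary `σ ↦ σ(x) - x` of a pair `(𝔞, x)`. -/
def trivializationsCoboundary : trivializations ℓ K L →+ (Gal(L/K) → Adified ℓ L) where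
  toFun p σ := Adified.mapOf (σ : L →+* L) p.1.2 - p.1.2
  map_zero' := by
    funext σ
    change Adified.mapOf (σ : L →+* L) 0 - 0 = 0
    rw [map_zero, sub_zero]
  map_add' p q := by
    funext σ
    change Adified.mapOf (σ : L →+* L) (p.1.2 + q.1.2) - (p.1.2 + q.1.2) = _
    rw [map_add]
    exact add_sub_add_comm _ _ _ _

variable (hLeo : LeopoldtConjecture ℓ L)
  (hmu : ∀ ζ ∈ mu ℓ L, ∃ ξ ∈ mu ℓ K, Units.map (algebraMap K L : K →* L) ξ = ζ)

include hLeo hmu in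
/-- A pair `(𝔞, x)` has a principal divisor `𝔞` if and only if `x` is invariant under the Galois
group. -/
theorem ker_trivializationsToCap [IsGalois K L] :
    (trivializationsToCap ℓ K L).ker = (trivializationsCoboundary ℓ K L).ker := by
  ext ⟨⟨a, x⟩, hx, hxa⟩
  dsimp only at hx hxa
  have h1 : (⟨⟨a, x⟩, hx, hxa⟩ : trivializations ℓ K L) ∈ (trivializationsToCap ℓ K L).ker ↔
      a ∈ principalBP ℓ K :=
    Subtype.ext_iff.trans (Submodule.Quotient.mk_eq_zero _)
  have h2 : (⟨⟨a, x⟩, hx, hxa⟩ : trivializations ℓ K L) ∈ (trivializationsCoboundary ℓ K L).ker ↔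
      ∀ σ : Gal(L/K), Adified.mapOf (σ : L →+* L) x = x :=
    funext_iff.trans (forall_congr' fun σ => sub_eq_zero)
  rw [h1, h2]
  constructor
  · rintro ⟨y, hy, rfl⟩ σ
    obtain ⟨ζ, hζ, h⟩ := exists_eq_one_tmul_of_divisor_eq_zero hLeo
      (sub_mem hx (mapOf_mem_pseudoInfinitesimal (algebraMap K L) hy))
      ((map_sub _ _ _).trans (sub_eq_zero.2 (hxa.trans (divisor_map ℓ K L y).symm)))
    obtain ⟨ξ, -, rfl⟩ := hmu ζ hζ
    have hxy : x = Adified.map ℓ K L (1 ⊗ₜ Additive.ofMul ξ + y) := by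
      rw [map_add]
      exact sub_eq_iff_eq_add.1 h
    rw [hxy, mapOf_map]
  · intro h
    obtain ⟨y, rfl⟩ := Adified.exists_map_eq_of_forall h
    refine ⟨y, mem_pseudoInfinitesimal_of_map hx, extDivisor_injective (L := L) ?_⟩
    rw [← hxa, divisor_map]

include hLeo hmu in
/-- The coboundary of a pair `(𝔞, x)` is a character with values in `μ_K`. -/
theorem exists_charToCochain_eq (p : trivializations ℓ K L) :
    ∃ χ, charToCochain ℓ K L χ = trivializationsCoboundary ℓ K L p := by
  obtain ⟨⟨a, x⟩, hx, hxa⟩ := p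
  dsimp only at hx hxa
  have h : ∀ σ : Gal(L/K), ∃ ξ : mu ℓ K, Adified.mapOf (σ : L →+* L) x - x =
      1 ⊗ₜ Additive.ofMul (Units.map (algebraMap K L : K →* L) (ξ : Kˣ)) := fun σ => by
    obtain ⟨ζ, hζ, h⟩ := exists_eq_one_tmul_of_divisor_eq_zero hLeo
      (sub_mem (mapOf_mem_pseudoInfinitesimal (σ : L →+* L) hx) hx)
      ((map_sub _ _ _).trans
        (sub_eq_zero.2 ((divisor_mapOf (σ : L →ₐ[K] L) hxa).trans hxa.symm)))
    obtain ⟨ξ, hξ, rfl⟩ := hmu ζ hζ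
    exact ⟨⟨ξ, hξ⟩, h⟩
  choose χ hχ using h
  have hχ' : ∀ σ : Gal(L/K), Adified.mapOf (σ : L →+* L) x =
      Adified.map ℓ K L (1 ⊗ₜ Additive.ofMul (χ σ : Kˣ)) + x := fun σ =>
    sub_eq_iff_eq_add.1 (hχ σ)
  refine ⟨Additive.ofMul (MonoidHom.mk' χ fun σ τ => ?_), funext fun σ => (hχ σ).symm⟩
  refine Subtype.ext (one_tmul_map_injOn (L := L) (χ (σ * τ)).2 (χ σ * χ τ).2 ?_)
  rw [← hχ, show ((σ * τ : Gal(L/K)) : L →+* L) = (σ : L →+* L).comp (τ : L →+* L) from rfl,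
    ← Adified.mapOf_comp, hχ' τ, map_add, mapOf_map, hχ' σ, Subgroup.coe_mul, map_mul, ofMul_mul,
    TensorProduct.tmul_add, ← add_assoc, add_sub_cancel_right, add_comm]
  rfl

lemma coboundary_eq_iff {χ : Gal(L/K) →* mu ℓ K} {x₀ : Lˣ}
    (hx₀ : ∀ σ : Gal(L/K), Units.map ((σ : L →+* L) : L →* L) x₀ =
      Units.map (algebraMap K L : K →* L) (χ σ : Kˣ) * x₀) (p : trivializations ℓ K L) :
    trivializationsCoboundary ℓ K L p = charToCochain ℓ K L (Additive.ofMul χ) ↔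
      ∀ σ : Gal(L/K), Adified.mapOf (σ : L →+* L) (p.1.2 - 1 ⊗ₜ Additive.ofMul x₀) =
        p.1.2 - 1 ⊗ₜ Additive.ofMul x₀ := by
  refine funext_iff.trans (forall_congr' fun σ => ?_)
  have h : Adified.mapOf (σ : L →+* L) (1 ⊗ₜ Additive.ofMul x₀ : Adified ℓ L) =
      charToCochain ℓ K L (Additive.ofMul χ) σ + 1 ⊗ₜ Additive.ofMul x₀ := by
    rw [Adified.mapOf_tmul, toMul_ofMul, hx₀, ofMul_mul, TensorProduct.tmul_add]
    rfl
  rw [map_sub, h]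
  change Adified.mapOf (σ : L →+* L) p.1.2 - p.1.2 = _ ↔ _
  rw [sub_eq_iff_eq_add, sub_eq_iff_eq_add]
  constructor <;> intro h' <;> rw [h'] <;> abel

/-- A character with values in `μ_K` is a coboundary of a pair `(𝔞, x)` if and only if its radical
generates a locally cyclotomic extension. -/
theorem exists_coboundary_eq_iff [IsGalois K L] (hℓ : ℓ ≠ 2) {χ : Gal(L/K) →* mu ℓ K} {x₀ : Lˣ}
    (hx₀ : ∀ σ : Gal(L/K), Units.map ((σ : L →+* L) : L →* L) x₀ =
      Units.map (algebraMap K L : K →* L) (χ σ : Kˣ) * x₀) :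
    (∃ p, trivializationsCoboundary ℓ K L p = charToCochain ℓ K L (Additive.ofMul χ)) ↔
      (x₀ : L) ∈ localCyclotomicPart ℓ K L := by
  obtain ⟨n, ζ₀, hζ₀, hn⟩ := exists_primitiveRoot_of_monoidHom χ
  obtain ⟨a, ha⟩ := exists_eq_pow_of_kummer hx₀ hn
  rw [mem_localCyclotomicPart_iff_of_pow_eq hℓ hζ₀ ha, ← exists_mem_pseudoInfinitesimal_iff ha]
  constructor
  · rintro ⟨p, hp⟩
    obtain ⟨y, hy⟩ := Adified.exists_map_eq_of_forall ((coboundary_eq_iff hx₀ p).1 hp)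
    refine ⟨y, ?_⟩
    rw [hy, add_sub_cancel]
    exact ⟨p.2.1, p.1.1, p.2.2⟩
  · rintro ⟨y, hy, d, hd⟩
    refine ⟨⟨(d, _), hy, hd⟩, (coboundary_eq_iff hx₀ _).2 fun σ => ?_⟩
    dsimp only
    rw [add_sub_cancel_left, mapOf_map]

include hLeo hmu in
/-- The coboundaries of the pairs `(𝔞, x)` are the characters of the Galois group of the maximal
locally cyclotomic subextension. -/
theorem range_trivializationsCoboundary [IsGalois K L] (hℓ : ℓ ≠ 2) (M : IntermediateField K L)
    [Normal K M] (hM : M = localCyclotomicPart ℓ K L) :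
    (trivializationsCoboundary ℓ K L).range =
      ((charToCochain ℓ K L).comp (inflation ℓ M)).range := by
  have key : ∀ χ : Gal(L/K) →* mu ℓ K,
      (∃ p, trivializationsCoboundary ℓ K L p = charToCochain ℓ K L (Additive.ofMul χ)) ↔
      ∃ χ' : Gal(M/K) →* mu ℓ K, χ'.comp (AlgEquiv.restrictNormalHom M) = χ := fun χ => by
    obtain ⟨x₀, hx₀⟩ := exists_kummer_generator χ
    rw [exists_coboundary_eq_iff hℓ hx₀, exists_comp_restrictNormalHom_iff M hx₀, hM]
  ext c
  constructor
  · rintro ⟨p, rfl⟩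
    obtain ⟨χ, hχ⟩ := exists_charToCochain_eq hLeo hmu p
    obtain ⟨χ', h⟩ := (key χ.toMul).1 ⟨p, hχ.symm⟩
    refine ⟨Additive.ofMul χ', ?_⟩
    rw [← hχ, AddMonoidHom.comp_apply]
    exact congrArg (fun ψ => charToCochain ℓ K L (Additive.ofMul ψ)) h
  · rintro ⟨χ', rfl⟩
    exact (key _).2 ⟨χ'.toMul, rfl⟩

include hLeo hmu in
/-- The group of trivializations modulo the common kernel of the class map and of the coboundary is
isomorphic to both sides. -/
theorem nonempty_capBP_addEquiv [IsGalois K L] (hℓ : ℓ ≠ 2) (M : IntermediateField K L)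
    [Normal K M] (hM : M = localCyclotomicPart ℓ K L) :
    Nonempty (CapBP ℓ K L ≃+ Additive (Gal(M/K) →* mu ℓ K)) :=
  ⟨(QuotientAddGroup.quotientKerEquivOfSurjective _ trivializationsToCap_surjective).symm.trans
    ((QuotientAddGroup.quotientAddEquivOfEq (ker_trivializationsToCap hLeo hmu)).trans
      ((QuotientAddGroup.quotientKerEquivRange _).trans
        ((AddEquiv.addSubgroupCongr (range_trivializationsCoboundary hLeo hmu hℓ M hM)).trans
          (AddMonoidHom.ofInjective (f := (charToCochain ℓ K L).comp (inflation ℓ M))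
            (charToCochain_injective.comp (inflation_injective M))).symm)))⟩

end Capitulation

end BertrandiasPayan

end

theorem mainTheorem12 (ℓ : ℕ) [Fact ℓ.Prime] (hℓ : ℓ ≠ 2)
    (K L : Type*) [Field K] [NumberField K] [Field L] [NumberField L] [Algebra K L]
    [IsGalois K L] (hG : IsPGroup ℓ Gal(L/K))
    (hLeo : BertrandiasPayan.LeopoldtConjecture ℓ L)
    (hdisj : (BertrandiasPayan.cyclotomic ℓ K (AlgebraicClosure L)).LinearDisjoint L) :
    IsGreatest {M : IntermediateField K L | BertrandiasPayan.IsLocallyCyclotomic ℓ K M}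
        (BertrandiasPayan.maxLocallyCyclotomic ℓ K L) ∧
      IsGalois K (BertrandiasPayan.maxLocallyCyclotomic ℓ K L) ∧
      Nonempty (BertrandiasPayan.CapBP ℓ K L ≃+
        Additive (Gal(BertrandiasPayan.maxLocallyCyclotomic ℓ K L/K) →*
          BertrandiasPayan.mu ℓ K)) := by
  have hGal := BertrandiasPayan.isGalois_maxLocallyCyclotomic (ℓ := ℓ) (K := K) (L := L)
  have hdeg : ∃ d, Module.finrank K L = ℓ ^ d := by
    rw [← IsGalois.card_aut_eq_finrank]
    exact IsPGroup.iff_card.1 hG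
  refine ⟨BertrandiasPayan.isGreatest_maxLocallyCyclotomic, hGal,
    BertrandiasPayan.nonempty_capBP_addEquiv hLeo ?_ hℓ _
      BertrandiasPayan.maxLocallyCyclotomic_eq⟩
  rintro ζ ⟨n, hn⟩
  obtain ⟨ξ, hξ⟩ := BertrandiasPayan.exists_algebraMap_eq_of_pow_eq_one hℓ hdeg hdisj
    (show (ζ : L) ^ ℓ ^ n = 1 by rw [← Units.val_pow_eq_pow_val, hn, Units.val_one])
  have hξ0 : ξ ≠ 0 := by
    rintro rfl
    exact ζ.ne_zero (by rw [← hξ, map_zero])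
  have hζ : Units.map (algebraMap K L : K →* L) (Units.mk0 ξ hξ0) = ζ := Units.ext hξ
  exact ⟨Units.mk0 ξ hξ0, ⟨n, Units.map_injective (algebraMap K L).injective 
    ((map_pow _ _ _).trans ((congrArg (· ^ ℓ ^ n) hζ).trans (hn.trans (map_one _).symm)))⟩, hζ⟩
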